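/- **Definitions.** For nonnegative bi-infinite sequences $I=(I_k)_{k\in\mathbb Z}$ and $\omega=(\omega_k)_{k\in\mathbb Z}$ with $\lim_{m\to-\infty}\sum_{i=m}^0(\omega_i-I_{i+1})=-\infty$, choose $G:\mathbb Z\to\mathbb R$ with $G_k-G_{k-1}=I_k$ (for instance with $G_0=0$), put $\widetilde G_\ell=\sup_{k\le\ell}\{G_k+\sum_{i=k}^{\ell}\omega_i\}$ and define the sequence $D(I,\omega)$ by $D(I,\omega)_\ell=\widetilde G_\ell-\widetilde G_{\ell-1}$. Let $D^{(1)}(\zeta)=\zeta$ and $D^{(m)}(\zeta^1,\dots,\zeta^m)=D\bigl(D^{(m-1)}(\zeta^1,\dots,\zeta^{m-1}),\zeta^m\bigr)$ for $m\ge2$. For $n\ge1$ let $\mathcal Y_n$ be the set of $I=(I^1,\dots,I^n)\in(\mathbb R_{\ge0}^{\mathbb Z})^n$ for which the limits $a_i=\lim_{m\to-\infty}|m|^{-1}\sum_{k=m}^0I^i_k$ exist, are finite and satisfy $0<a_1<\dots<a_n$. Let $\mathcal X_n$ be the set of $\eta=(\eta^1,\dots,\eta^n)\in(\mathbb R_{\ge0}^{\mathbb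 Z})^n$ with $\eta^{i}_k\ge\eta^{i-1}_k$ for all $2\le i\le n$ and $k\in\mathbb Z$ and with $\liminf_{m\to-\infty}|m|^{-1}\sum_{k=m}^0\eta^1_k>0$. Both carry the product topology and its Borel $\sigma$-algebra. For $I\in\mathcal Y_n$ define $\mathcal D^{(n)}(I)=(\eta^1,\dots,\eta^n)$ by $\eta^i=D^{(i)}(I^i,I^{i-1},\dots,I^1)$. For $\rho=(\rho_1,\dots,\rho_n)$ with $0<\rho_1<\dots<\rho_n$ let $\nu^\rho$ be the law of $I$ when all coordinates $I^i_k$ ($1\le i\le n$, $k\in\mathbb Z$) are independent and $I^i_k$ is exponential with mean $\rho_i$, and let $\mu^\rho=\nu^\rho\circ(\mathcal D^{(n)})^{-1}$ be its image under $\mathcal D^{(n)}$. Translations act by $(\theta_\ell\eta)^i_k=\eta^i_{k+\ell}$; a probability measure $Q$ is translation-ergodic if it is invariant under all $\theta_\ell$, $\ell\in\mathbb Z$, and $Q(A)\in\{0,1\}$ for every Borel set $A$ that is invariant under all $\theta_\ell$. **Theorem.** Let $n\ge1$. The map $\mathcal D^{(n)}$ sends $\mathcal Y_n$ into $\mathcal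 X_n$, and for every $\rho$ with $0<\rho_1<\dots<\rho_n$ one has $\nu^\rho(\mathcal Y_n)=1$, so that $\mu^\rho$ is a probability measure on $\mathcal X_n$. Moreover: 1. (Ergodicity.) Each $\mu^\rho$ is translation-ergodic. 2. (Continuity.) The map $\rho\mapsto\mu^\rho$, from $\{\rho\in\mathbb R^n:0<\rho_1<\dots<\rho_n\}$ to the probability measures on $\mathcal X_n$ with the weak topology, is continuous. 3. (Consistency.) If $(\eta^1,\dots,\eta^n)\sim\mu^{(\rho_1,\dots,\rho_n)}$, then $(\eta^1,\dots,\eta^{j-1},\eta^{j+1},\dots,\eta^n)\sim\mu^{(\rho_1,\dots,\rho_{j-1},\rho_{j+1},\dots,\rho_n)}$ for every $j\in\{1,\dots,n\}$. (For $n=1$ both sides are the unique probability measure on the one-point space of empty tuples.) -/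

import Mathlib

open MeasureTheory ProbabilityTheory Filter Topology

noncomputable section

namespace MultiQueue

/-- `n`-tuples `(η^1, …, η^n)` of bi-infinite real sequences, `η i k` being `η^{i+1}_k`, with the
product topology and product (= Borel) σ-algebra. Nonnegativity of the entries is part of the sets
`arrivalSpace` and `outputSpace` below. -/
abbrev Seqs (n : ℕ) : Type := Fin n → ℤ → ℝ

/-! ### The queueing operator -/

/-- The arrival times: the function `G` on `ℤ` with increments `I_k = G_k - G_{k-1}`, normalized by
`G_0 = 0`. -/
def arrivalTime (I : ℤ → ℝ) (k : ℤ) : ℝ :=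
  ∑ i ∈ Finset.Ioc 0 k, I i - ∑ i ∈ Finset.Ioc k 0, I i

theorem arrivalTime_zero (I : ℤ → ℝ) : arrivalTime I 0 = 0 := by
  simp [arrivalTime]

theorem arrivalTime_sub (I : ℤ → ℝ) (k : ℤ) :
    arrivalTime I k - arrivalTime I (k - 1) = I k := by
  unfold arrivalTime
  rcases le_or_gt k 0 with h | h
  · rw [Finset.Ioc_eq_empty (by omega : ¬ (0 < k)), Finset.Ioc_eq_empty (by omega : ¬ (0 < k - 1))]
    have : Finset.Ioc (k - 1) 0 = insert k (Finset.Ioc k 0) := by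
      ext x; simp only [Finset.mem_Ioc, Finset.mem_insert]; omega
    rw [this, Finset.sum_insert (by simp)]; simp
  · rw [Finset.Ioc_eq_empty (by omega : ¬ (k < 0)), Finset.Ioc_eq_empty (by omega : ¬ (k - 1 < 0))]
    have : Finset.Ioc 0 k = insert k (Finset.Ioc 0 (k - 1)) := by
      ext x; simp only [Finset.mem_Ioc, Finset.mem_insert]; omega
    rw [this, Finset.sum_insert (by simp)]; simp

/-- The departure times `G̃_ℓ = sup_{k ≤ ℓ} (G_k + ∑_{i=k}^ℓ ω_i)`. -/
def departureTime (I ω : ℤ → ℝ) (l : ℤ) : ℝ :=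
  ⨆ k : Set.Iic l, (arrivalTime I k + ∑ i ∈ Finset.Icc (k : ℤ) l, ω i)

/-- The queueing operator `D(I, ω)`: the interdeparture times `Ĩ_ℓ = G̃_ℓ - G̃_{ℓ-1}` of the queue
with arrival process `I` and service process `ω`. (Meaningful when the suprema above are finite;
this is so wherever `jointMap` below is evaluated on `arrivalSpace`.) -/
def queueMap (I ω : ℤ → ℝ) (l : ℤ) : ℝ :=
  departureTime I ω l - departureTime I ω (l - 1)

/-- The multiqueue operators: `multiQueueMap m (ζ^1, …, ζ^{m+1})` is `D^{(m+1)}(ζ^1, …, ζ^{m+1})`,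
where `D^{(1)}(ζ) = ζ` and
`D^{(m+1)}(ζ^1, …, ζ^{m+1}) = D(D^{(m)}(ζ^1, …, ζ^m), ζ^{m+1})`. -/
def multiQueueMap : (m : ℕ) → (Fin (m + 1) → ℤ → ℝ) → ℤ → ℝ
  | 0, ζ => ζ 0
  | m + 1, ζ => queueMap (multiQueueMap m fun t => ζ t.castSucc) (ζ (Fin.last (m + 1)))

/-- The map `𝒟^{(n)}`: `I ↦ η` with `η^i = D^{(i)}(I^i, I^{i-1}, …, I^1)` for `i = 1, …, n`. -/
def jointMap (n : ℕ) (I : Seqs n) : Seqs n := fun i =>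
  multiQueueMap i fun t : Fin (i + 1) => I ⟨i - t, lt_of_le_of_lt (Nat.sub_le _ _) i.isLt⟩

/-! ### The sequence spaces -/

/-- The averages `|m|⁻¹ ∑_{k=m}^0 x_k` with `m = -N`. -/
def backwardAvg (x : ℤ → ℝ) (N : ℕ) : ℝ :=
  (∑ k ∈ Finset.Icc (-(N : ℤ)) 0, x k) / N

/-- The space `𝒴_n` of `n`-tuples of nonnegative sequences whose backward Cesàro limits exist, are
positive and are strictly increasing in the index of the sequence. -/
def arrivalSpace (n : ℕ) : Set (Seqs n) :=
  {I | (∀ i k, 0 ≤ I i k) ∧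
    ∃ a : Fin n → ℝ, (∀ i, Tendsto (backwardAvg (I i)) atTop (𝓝 (a i))) ∧
      (∀ i, 0 < a i) ∧ StrictMono a}

/-- The space `𝒳_n` of `n`-tuples of nonnegative sequences that are coordinatewise nondecreasing in
the index of the sequence and such that the lower backward Cesàro limit of the first one, an extended
real number, is positive. -/
def outputSpace (n : ℕ) : Set (Seqs n) :=
  {η | (∀ i k, 0 ≤ η i k) ∧ (∀ i j : Fin n, (i : ℕ) + 1 = j → ∀ k, η i k ≤ η j k) ∧
    ∀ i : Fin n, (i : ℕ) = 0 → 0 < liminf (fun N => (backwardAvg (η i) N : EReal)) atTop}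

/-! ### The measures -/

/-- The parameter vectors `0 < ρ_1 < ⋯ < ρ_n`. -/
def paramSpace (n : ℕ) : Set (Fin n → ℝ) :=
  {ρ | (∀ i, 0 < ρ i) ∧ StrictMono ρ}

/-- `ν^ρ`: all coordinates `I^i_k` are independent, and `I^i_k` is exponential with mean `ρ_i`,
that is, with rate `ρ_i⁻¹`. -/
def nu {n : ℕ} (ρ : Fin n → ℝ) : Measure (Seqs n) :=
  Measure.infinitePi fun i => Measure.infinitePi fun _ : ℤ => expMeasure (ρ i)⁻¹

/-- `μ^ρ`, the image of `ν^ρ` under `𝒟^{(n)}`. -/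
def mu {n : ℕ} (ρ : Fin n → ℝ) : Measure (Seqs n) :=
  (nu ρ).map (jointMap n)

/-- The translations `(θ_ℓ η)^i_k = η^i_{k+ℓ}`. -/
def shift {n : ℕ} (l : ℤ) (η : Seqs n) : Seqs n := fun i k => η i (k + l)

/-- Translation-ergodic probability measures: translation-invariant, and every translation-invariant
Borel set has probability `0` or `1`. -/
structure IsTranslationErgodic {n : ℕ} (Q : Measure (Seqs n)) : Prop where
  isProbabilityMeasure : IsProbabilityMeasure Q
  map_shift : ∀ l : ℤ, Q.map (shift l) = Q
  zero_or_one : ∀ A : Set (Seqs n), MeasurableSet A → (∀ l : ℤ, shift l ⁻¹' A = A) →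
    Q A = 0 ∨ Q A = 1

/-- Deletion of the `j`-th sequence. -/
def deleteSeq {n : ℕ} (j : Fin (n + 1)) (η : Seqs (n + 1)) : Seqs n := fun i => η (j.succAbove i)

/-- Deletion of the `j`-th parameter. -/
def deleteParam {n : ℕ} (j : Fin (n + 1)) (ρ : Fin (n + 1) → ℝ) : Fin n → ℝ :=
  fun i => ρ (j.succAbove i)

end MultiQueue

end

noncomputable section

namespace MultiQueue

/-! ### Partial sums and running suprema -/

/-! Write `R(I, ω)` for the dual services `dualService I ω`. Three facts about a single queue carry
the theorem.

Stability: if arrivals have average `a` and services average `b < a`, the suprema are finite and the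
departures again have average `a` (`Regular.queueMap`). Thus all queues inside `𝒟` are stable and
the outputs inherit the averages of the inputs. Near a given parameter the suprema are maxima over
fixed finite windows, hence continuous.

Burke's theorem (`measurePreserving_queueMap_dualService`): for independent exponential sequences
with means `b < a`, the pair `(D(I, ω), R(I, ω))` has the law of `(I, ω)`. For a single customer
this is an invariance of a product of three exponential laws; a queue started at `-n` in equilibrium
transports it to the limit.

Interchange (`queueMap_queueMap`): `D(D(A, B), C) = D(D(A, R(B, C)), D(B, C))`. Both sides are last
passage times across three lines, and replacing `(B, C)` by `(R(B, C), D(B, C))` does not change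
last passage values across two lines.

By `jointMap_succ`, the outputs after the first arise from the joint map of `I^2, …, I^n` through a
common last service `I^1`. Burke, interchange and induction show that `μ^ρ` is invariant under an
independent exponential service of mean below all `ρ_i` (`measurePreserving_queueAll_mu`). This is
consistency for the deletion of the first sequence; other deletions commute with the last service.
Ergodicity passes from `ν^ρ` to its image because `𝒟` commutes with translations. For continuity,
all `ν^ρ` are obtained by scaling one family of unit exponentials, and dominated convergence
applies. -/

theorem sum_Icc_eq_arrivalTime_sub (x : ℤ → ℝ) {k l : ℤ} (h : k ≤ l + 1) :
    ∑ i ∈ Finset.Icc k l, x i = arrivalTime x l - arrivalTime x (k - 1) := by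
  obtain ⟨N, rfl⟩ : ∃ N : ℕ, l = k - 1 + N := ⟨(l - (k - 1)).toNat, by omega⟩
  clear h
  induction N with
  | zero => simp
  | succ N ih =>
    have h1 : Finset.Icc k (k - 1 + (N + 1 : ℕ)) =
        insert (k - 1 + (N + 1 : ℕ)) (Finset.Icc k (k - 1 + N)) := by
      ext z; simp only [Finset.mem_Icc, Finset.mem_insert]; push_cast; omega
    rw [h1, Finset.sum_insert (by simp), ih, ← arrivalTime_sub x (k - 1 + (N + 1 : ℕ))]
    have : k - 1 + ((N + 1 : ℕ) : ℤ) - 1 = k - 1 + N := by push_cast; ring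
    rw [this]; ring

theorem eq_of_increments {f g : ℤ → ℝ} (h : ∀ k, f k - f (k - 1) = g k - g (k - 1)) (k : ℤ) :
    f k - f 0 = g k - g 0 := by
  induction k using Int.induction_on with
  | zero => simp
  | succ i ih => have := h (i + 1); rw [add_sub_cancel_right] at this; linarith
  | pred i ih => have := h (-i); linarith

theorem arrivalTime_increments (f : ℤ → ℝ) (k : ℤ) :
    arrivalTime (fun l => f l - f (l - 1)) k = f k - f 0 := by
  have := eq_of_increments (f := arrivalTime fun l => f l - f (l - 1)) (g := f)
    (arrivalTime_sub _) k
  rwa [arrivalTime_zero, sub_zero] at this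

/-- The running supremum of a function on `ℤ`. -/
def runSup (W : ℤ → ℝ) (l : ℤ) : ℝ := ⨆ k : Set.Iic l, W k

/-- All running suprema of `W` are finite. -/
def BddToLeft (W : ℤ → ℝ) : Prop := ∀ l : ℤ, BddAbove (Set.range fun k : Set.Iic l => W k)

theorem BddToLeft.le_runSup {W : ℤ → ℝ} (h : BddToLeft W) {k l : ℤ} (hk : k ≤ l) :
    W k ≤ runSup W l :=
  le_ciSup (h l) (⟨k, hk⟩ : Set.Iic l)

theorem runSup_le {W : ℤ → ℝ} {l : ℤ} {u : ℝ} (h : ∀ k ≤ l, W k ≤ u) : runSup W l ≤ u :=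
  have : Nonempty (Set.Iic l) := ⟨⟨l, le_refl l⟩⟩
  ciSup_le fun k => h k k.2

/-- Only finitely many indices lie between two right endpoints, so one finite running supremum makes
all of them finite. -/
theorem bddToLeft_of_le {W : ℤ → ℝ} {l : ℤ} {u : ℝ} (h : ∀ k ≤ l, W k ≤ u) :
    BddToLeft W := by
  intro m
  obtain ⟨v, hv⟩ := ((Set.finite_Icc l m).image W).bddAbove
  refine ⟨max u v, ?_⟩
  rintro _ ⟨⟨k, hk⟩, rfl⟩
  rcases le_total k l with h' | h'
  · exact le_max_of_le_left (h k h')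
  · exact le_max_of_le_right (hv ⟨k, ⟨h', hk⟩, rfl⟩)

theorem BddToLeft.runSup_eq_max {W : ℤ → ℝ} (h : BddToLeft W) (l : ℤ) :
    runSup W l = max (W l) (runSup W (l - 1)) := by
  apply le_antisymm
  · refine runSup_le fun k hk => ?_
    rcases eq_or_lt_of_le hk with rfl | hk
    · exact le_max_left _ _
    · exact le_max_of_le_right (h.le_runSup (by omega))
  · exact max_le (h.le_runSup le_rfl) (runSup_le fun k hk => h.le_runSup (by omega))

/-! ### The queue -/

/-- The function whose running supremum gives the departure times. -/
def weight (I ω : ℤ → ℝ) (k : ℤ) : ℝ := arrivalTime I k - arrivalTime ω (k - 1)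

/-- All departure times are finite. -/
def Stable (I ω : ℤ → ℝ) : Prop := BddToLeft (weight I ω)

/-- The time spent in the queue by each customer. -/
def sojourn (I ω : ℤ → ℝ) (l : ℤ) : ℝ := departureTime I ω l - arrivalTime I l

/-- The dual service times `ω̃_l = min(I_l, J_{l-1})`. -/
def dualService (I ω : ℤ → ℝ) (l : ℤ) : ℝ := min (I l) (sojourn I ω (l - 1))

theorem departureTime_summand (I ω : ℤ → ℝ) (l : ℤ) (k : Set.Iic l) :
    arrivalTime I k + ∑ i ∈ Finset.Icc (k : ℤ) l, ω i = arrivalTime ω l + weight I ω k := by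
  have : (k : ℤ) ≤ l := k.2
  rw [sum_Icc_eq_arrivalTime_sub _ (by omega), weight]; ring

variable {I ω : ℤ → ℝ}

theorem Stable.departureTime_eq (h : Stable I ω) (l : ℤ) :
    departureTime I ω l = arrivalTime ω l + runSup (weight I ω) l := by
  have : Nonempty (Set.Iic l) := ⟨⟨l, le_refl l⟩⟩
  simp only [departureTime, departureTime_summand, runSup]
  exact (add_ciSup (h l) _).symm

/-- An unbounded real supremum takes the default value zero, and by `bddToLeft_of_le` unboundedness
occurs at every `l` simultaneously. This lets translation equivariance hold without exceptional
sequences. -/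
theorem departureTime_eq_zero (h : ¬ Stable I ω) : departureTime I ω = 0 := by
  ext l
  have hl : ¬ BddAbove (Set.range fun k : Set.Iic l =>
      arrivalTime I k + ∑ i ∈ Finset.Icc (k : ℤ) l, ω i) := by
    rintro ⟨u, hu⟩
    refine h (bddToLeft_of_le (l := l) (u := u - arrivalTime ω l) fun k hk => ?_)
    have := hu ⟨⟨k, hk⟩, rfl⟩
    have e := departureTime_summand I ω l ⟨k, hk⟩
    simp only at this e
    linarith
  exact Real.iSup_of_not_bddAbove hl

theorem arrivalTime_shift (x : ℤ → ℝ) (c k : ℤ) :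
    arrivalTime (fun k => x (k + c)) k = arrivalTime x (k + c) - arrivalTime x c := by
  have := arrivalTime_increments (fun k => arrivalTime x (k + c)) k
  rw [zero_add] at this
  rw [← this]
  congr 1
  ext k
  rw [← arrivalTime_sub x (k + c), show k + c - 1 = k - 1 + c by ring]

theorem weight_shift (I ω : ℤ → ℝ) (c k : ℤ) :
    weight (fun k => I (k + c)) (fun k => ω (k + c)) k =
      weight I ω (k + c) - (arrivalTime I c - arrivalTime ω c) := by
  rw [weight, weight, arrivalTime_shift, arrivalTime_shift, show k - 1 + c = k + c - 1 by ring]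
  ring

theorem Stable.shift (h : Stable I ω) (c : ℤ) :
    Stable (fun k => I (k + c)) (fun k => ω (k + c)) :=
  bddToLeft_of_le (l := 0) (u := runSup (weight I ω) c - (arrivalTime I c - arrivalTime ω c))
    fun k hk => by
      rw [weight_shift]
      linarith [BddToLeft.le_runSup h (show k + c ≤ c by omega)]

theorem runSup_weight_shift (h : Stable I ω) (c l : ℤ) :
    runSup (weight (fun k => I (k + c)) (fun k => ω (k + c))) l =
      runSup (weight I ω) (l + c) - (arrivalTime I c - arrivalTime ω c) := by
  apply le_antisymm
  · refine runSup_le fun k hk => ?_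
    rw [weight_shift]
    linarith [BddToLeft.le_runSup h (show k + c ≤ l + c by omega)]
  · rw [sub_le_iff_le_add]
    refine runSup_le fun k hk => ?_
    have := BddToLeft.le_runSup (h.shift c) (show k - c ≤ l by omega)
    rw [weight_shift, sub_add_cancel] at this
    linarith

/-- The queue commutes with translations, also where it is not stable. -/
theorem queueMap_shift (I ω : ℤ → ℝ) (c l : ℤ) :
    queueMap (fun k => I (k + c)) (fun k => ω (k + c)) l = queueMap I ω (l + c) := by
  by_cases h : Stable I ω
  · rw [queueMap, queueMap, h.departureTime_eq, h.departureTime_eq, (h.shift c).departureTime_eq,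
      (h.shift c).departureTime_eq, runSup_weight_shift h, runSup_weight_shift h,
      arrivalTime_shift, arrivalTime_shift, show l - 1 + c = l + c - 1 by ring]
    ring
  · have h' : ¬ Stable (fun k => I (k + c)) (fun k => ω (k + c)) := fun h' => h <| by
      simpa using h'.shift (-c)
    rw [queueMap, queueMap, departureTime_eq_zero h, departureTime_eq_zero h']
    simp

/-- Lindley's recursion: service starts at the later of the customer's own arrival and the
predecessor's departure. The next two lemmas are its forms for interdeparture and sojourn times. -/
theorem Stable.departureTime_eq_max (h : Stable I ω) (l : ℤ) :
    departureTime I ω l = max (arrivalTime I l) (departureTime I ω (l - 1)) + ω l := by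
  have h1 := arrivalTime_sub ω l
  rw [h.departureTime_eq, h.departureTime_eq, BddToLeft.runSup_eq_max h, weight,
    ← max_add_add_left, ← max_add_add_right]
  congr 1 <;> linarith

theorem Stable.queueMap_eq (h : Stable I ω) (l : ℤ) :
    queueMap I ω l = ω l + max 0 (I l - sojourn I ω (l - 1)) := by
  have h1 := arrivalTime_sub I l
  have h2 : max 0 (I l - sojourn I ω (l - 1)) =
      max (arrivalTime I l) (departureTime I ω (l - 1)) - departureTime I ω (l - 1) := by
    rw [max_comm, ← max_sub_sub_right, sojourn]
    congr 1 <;> linarith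
  rw [queueMap, h.departureTime_eq_max, h2]; ring

theorem Stable.sojourn_eq (h : Stable I ω) (l : ℤ) :
    sojourn I ω l = ω l + max 0 (sojourn I ω (l - 1) - I l) := by
  have h1 := arrivalTime_sub I l
  have h2 : max 0 (sojourn I ω (l - 1) - I l) =
      max (arrivalTime I l) (departureTime I ω (l - 1)) - arrivalTime I l := by
    rw [← max_sub_sub_right, sojourn]
    congr 1 <;> linarith
  rw [h2, sojourn, h.departureTime_eq_max]; ring

theorem Stable.le_sojourn (h : Stable I ω) (l : ℤ) : ω l ≤ sojourn I ω l := by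
  rw [h.sojourn_eq]; linarith [le_max_left 0 (sojourn I ω (l - 1) - I l)]

theorem Stable.le_queueMap (h : Stable I ω) (l : ℤ) : ω l ≤ queueMap I ω l := by
  rw [h.queueMap_eq]; linarith [le_max_left 0 (I l - sojourn I ω (l - 1))]

/-- Holds because `max 0 (i - J) + min i J = i`. This conservation law determines the average of the
dual services. -/
theorem Stable.dualService_add_queueMap (h : Stable I ω) (l : ℤ) :
    dualService I ω l + queueMap I ω l = I l + ω l := by
  rw [h.queueMap_eq, dualService]
  rcases le_total (I l) (sojourn I ω (l - 1)) with h | h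
  · rw [min_eq_left h, max_eq_left (by linarith)]; ring
  · rw [min_eq_right h, max_eq_right (by linarith)]; ring

theorem arrivalTime_queueMap (I ω : ℤ → ℝ) (l : ℤ) :
    arrivalTime (queueMap I ω) l = departureTime I ω l - departureTime I ω 0 :=
  arrivalTime_increments _ l

theorem arrivalTime_sub_arrivalTime_mono {x y : ℤ → ℝ} (h : ∀ k, x k ≤ y k) {k l : ℤ}
    (hkl : k ≤ l) : arrivalTime x l - arrivalTime x k ≤ arrivalTime y l - arrivalTime y k := by
  have h1 := sum_Icc_eq_arrivalTime_sub x (k := k + 1) (l := l) (by omega)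
  have h2 := sum_Icc_eq_arrivalTime_sub y (k := k + 1) (l := l) (by omega)
  rw [add_sub_cancel_right] at h1 h2
  rw [← h1, ← h2]
  exact Finset.sum_le_sum fun i _ => h i

/-- More widely spaced arrivals are more widely spaced after service. -/
theorem queueMap_mono {I' : ℤ → ℝ} (h : Stable I ω) (h' : Stable I' ω) (hI : ∀ k, I k ≤ I' k)
    (l : ℤ) : queueMap I ω l ≤ queueMap I' ω l := by
  -- The sojourn time at `l` is the supremum over `k ≤ l` of the total service from `k` to `l` minus
  -- the time between the arrivals of `k` and `l`; wider spacing lowers it.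
  have hJ : ∀ l, sojourn I' ω l ≤ sojourn I ω l := by
    intro l
    rw [sojourn, sojourn, h.departureTime_eq, h'.departureTime_eq]
    have : runSup (weight I' ω) l ≤ runSup (weight I ω) l + (arrivalTime I' l - arrivalTime I l) := by
      refine runSup_le fun k hk => ?_
      have h1 := arrivalTime_sub_arrivalTime_mono hI hk
      have h2 := BddToLeft.le_runSup h hk
      simp only [weight] at h2 ⊢
      linarith
    linarith
  rw [h.queueMap_eq, h'.queueMap_eq]
  have := hI l
  have := hJ (l - 1)
  gcongr

/-! ### Last passage across two lines and the interchange identity -/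

/-- The last passage value `max_{k ≤ j ≤ k + N} (x_k + ⋯ + x_j + y_j + ⋯ + y_{k+N})`. -/
def twoLine (x y : ℤ → ℝ) (k : ℤ) : ℕ → ℝ
  | 0 => x k + y k
  | N + 1 => max (twoLine x y k N) (arrivalTime x (k + N + 1) - arrivalTime x (k - 1)) +
      y (k + N + 1)

/-- Together with `exists_twoLine_eq` this identifies the recursion with the maximum over crossing
points: the recursion suits induction on `N`, the maximum suits the suprema of the queue. -/
theorem le_twoLine (x y : ℤ → ℝ) (k : ℤ) (N : ℕ) (j : ℤ) (hk : k ≤ j) (hj : j ≤ k + N) :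
    arrivalTime x j - arrivalTime x (k - 1) + (arrivalTime y (k + N) - arrivalTime y (j - 1)) ≤
      twoLine x y k N := by
  induction N with
  | zero =>
    obtain rfl : j = k := by simp at hj; omega
    have h1 := arrivalTime_sub x j
    have h2 := arrivalTime_sub y j
    simp only [twoLine]
    simp only [Nat.cast_zero, add_zero]
    linarith
  | succ N ih =>
    have h1 := arrivalTime_sub y (k + N + 1)
    rw [add_sub_cancel_right] at h1
    simp only [twoLine]
    push_cast at hj ⊢
    rw [← add_assoc]
    rcases (show j ≤ k + N ∨ j = k + N + 1 by omega) with h | rfl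
    · have := ih h
      have := le_max_left (twoLine x y k N) (arrivalTime x (k + N + 1) - arrivalTime x (k - 1))
      linarith
    · have := le_max_right (twoLine x y k N) (arrivalTime x (k + N + 1) - arrivalTime x (k - 1))
      rw [add_sub_cancel_right]
      linarith

theorem exists_twoLine_eq (x y : ℤ → ℝ) (k : ℤ) (N : ℕ) : ∃ j, k ≤ j ∧ j ≤ k + N ∧
    twoLine x y k N =
    arrivalTime x j - arrivalTime x (k - 1) + (arrivalTime y (k + N) - arrivalTime y (j - 1)) := by
  induction N with
  | zero =>
    refine ⟨k, le_rfl, by simp, ?_⟩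
    have h1 := arrivalTime_sub x k
    have h2 := arrivalTime_sub y k
    simp only [twoLine, Nat.cast_zero, add_zero]
    linarith
  | succ N ih =>
    obtain ⟨j, hk, hj, h⟩ := ih
    have h1 := arrivalTime_sub y (k + N + 1)
    rw [add_sub_cancel_right] at h1
    simp only [twoLine]
    push_cast
    rw [← add_assoc]
    rcases max_choice (twoLine x y k N) (arrivalTime x (k + N + 1) - arrivalTime x (k - 1))
      with h' | h'
    · exact ⟨j, hk, by omega, by rw [h', h]; linarith⟩
    · exact ⟨k + N + 1, by omega, le_rfl, by rw [h', add_sub_cancel_right]; linarith⟩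

/-- The map `(I, ω) ↦ (ω̃, D(I, ω))` preserves last passage values across the two lines. -/
theorem Stable.twoLine_dualService_queueMap (h : Stable I ω) (k : ℤ) (N : ℕ) :
    twoLine (dualService I ω) (queueMap I ω) k N = twoLine I ω k N ∧
      arrivalTime I (k + N) - arrivalTime I (k - 1) + sojourn I ω (k + N) =
        max (twoLine I ω k N) (arrivalTime (dualService I ω) (k + N) -
          arrivalTime (dualService I ω) (k - 1) + sojourn I ω (k + N)) := by
  -- The second conjunct strengthens the induction: it controls how the partial sums of `I` and of
  -- the dual services, both of which enter `twoLine`, can differ.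
  induction N with
  | zero =>
    have h1 := arrivalTime_sub I k
    have h2 := arrivalTime_sub (dualService I ω) k
    have h3 := h.sojourn_eq k
    simp only [twoLine, Nat.cast_zero, add_zero]
    refine ⟨h.dualService_add_queueMap k, ?_⟩
    rw [h1, h2, h3, dualService]
    rcases le_total (I k) (sojourn I ω (k - 1)) with h | h
    · rw [min_eq_left h, max_eq_right (by linarith : (0 : ℝ) ≤ sojourn I ω (k - 1) - I k),
        max_eq_right (by linarith)]
    · rw [min_eq_right h, max_eq_left (by linarith : sojourn I ω (k - 1) - I k ≤ 0),
        max_eq_left (by linarith)]; ring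
  | succ N ih =>
    obtain ⟨h0, hs⟩ := ih
    have h1 := arrivalTime_sub I (k + N + 1)
    have h2 := arrivalTime_sub (dualService I ω) (k + N + 1)
    have h3 := h.sojourn_eq (k + N + 1)
    have h4 := h.queueMap_eq (k + N + 1)
    simp only [dualService] at h2
    rw [add_sub_cancel_right] at h1 h2 h3 h4
    simp only [twoLine]
    push_cast
    rw [← add_assoc, h0, h3, h4]
    have e1 : arrivalTime I (k + N + 1) = arrivalTime I (k + N) + I (k + N + 1) := by linarith
    have e2 : arrivalTime (dualService I ω) (k + N + 1) =
      arrivalTime (dualService I ω) (k + N) + min (I (k + N + 1)) (sojourn I ω (k + N)) := by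
      linarith
    rw [e1, e2]
    generalize arrivalTime I (k + N) = p at *
    generalize arrivalTime I (k - 1) = p' at *
    generalize arrivalTime (dualService I ω) (k + N) = q at *
    generalize arrivalTime (dualService I ω) (k - 1) = q' at *
    generalize I (k + N + 1) = i at *
    generalize ω (k + N + 1) = w at *
    generalize sojourn I ω (k + N) = J at *
    generalize twoLine I ω k N = L at *
    clear h h0 h1 h2 h3 h4 e1 e2
    -- With `S = p - p'` and `S' = q - q'` the hypothesis is `S + J = max L (S' + J)`, and the first
    -- goal amounts to `max L (S' + min i J) + max 0 (i - J) = max L (S + i)`. If `J ≤ i`, both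
    -- sides equal `S + i`. If `i < J`, either `S = S'`, or `S + J = L` and both `S + i` and `S' +
    -- i` are at most `L`. The second goal is a similar case distinction.
    grind

/-- Two queues in series compute last passage across three lines, and `B` and `C` enter only through
`twoLine B C`. The added constant undoes the normalization at `0` of the arrival times at the second
queue. -/
theorem isLUB_departureTime_queueMap {A B C : ℤ → ℝ} (hAB : Stable A B)
    (hC : Stable (queueMap A B) C) (l : ℤ) :
    IsLUB {z | ∃ (k : ℤ) (N : ℕ), k + N = l ∧ z = arrivalTime A k + twoLine B C k N}
      (departureTime (queueMap A B) C l + departureTime A B 0) := by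
  rw [hC.departureTime_eq]
  constructor
  · rintro z ⟨k, N, rfl, rfl⟩
    obtain ⟨j, hk, hj, h⟩ := exists_twoLine_eq B C k N
    have h1 := BddToLeft.le_runSup hC hj
    have h2 := BddToLeft.le_runSup hAB hk
    rw [weight, arrivalTime_queueMap] at h1
    rw [hAB.departureTime_eq j] at h1
    rw [weight] at h2
    linarith
  · intro u hu
    rw [← le_sub_iff_add_le, ← le_sub_iff_add_le']
    refine runSup_le fun j hj => ?_
    rw [weight, arrivalTime_queueMap, hAB.departureTime_eq j]
    have : runSup (weight A B) j ≤ u - arrivalTime C l + arrivalTime C (j - 1) -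
        arrivalTime B j := by
      refine runSup_le fun k hk => ?_
      obtain ⟨N, rfl⟩ : ∃ N : ℕ, l = k + N := ⟨(l - k).toNat, by omega⟩
      have h1 := le_twoLine B C k N j hk hj
      have h2 := hu ⟨k, N, rfl, rfl⟩
      rw [weight]
      linarith
    linarith

/-- The interchange identity `D(D(A, B), C) = D(D(A, R(B, C)), D(B, C))`. -/
theorem queueMap_queueMap {A B C : ℤ → ℝ} (hAB : Stable A B) (hC : Stable (queueMap A B) C)
    (hBC : Stable B C) (hAR : Stable A (dualService B C))
    (hD : Stable (queueMap A (dualService B C)) (queueMap B C)) :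
    queueMap (queueMap A B) C = queueMap (queueMap A (dualService B C)) (queueMap B C) := by
  -- Since `twoLine` is unchanged under `(B, C) ↦ (R(B, C), D(B, C))`, both sides are least upper
  -- bounds of one set; the constants cancel in the increments.
  have h : ∀ l, departureTime (queueMap A B) C l + departureTime A B 0 =
      departureTime (queueMap A (dualService B C)) (queueMap B C) l +
        departureTime A (dualService B C) 0 := by
    intro l
    have h1 := isLUB_departureTime_queueMap hAB hC l
    have h2 := isLUB_departureTime_queueMap hAR hD l
    simp only [(hBC.twoLine_dualService_queueMap _ _).1] at h2
    exact h1.unique h2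
  ext l
  rw [queueMap, queueMap]
  linarith [h l, h (l - 1)]

/-! ### Slopes at `-∞`, uniformly in a parameter -/

/-- `W t k = c k + o(k)` as `k → -∞`, uniformly for `t` along `F`. -/
def HasSlope {T : Type*} (F : Filter T) (W : T → ℤ → ℝ) (c : ℝ) : Prop :=
  (fun p : T × ℤ => W p.1 p.2 - c * p.2) =o[F ×ˢ atBot] fun p => (p.2 : ℝ)

section Slope

variable {T : Type*} {F : Filter T} {W V : T → ℤ → ℝ} {c d : ℝ}

theorem hasSlope_iff : HasSlope F W c ↔ ∀ ε > 0, ∃ K < (0 : ℤ), ∀ᶠ t in F, ∀ k ≤ K,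
    |W t k - c * k| ≤ ε * -k := by
  rw [HasSlope, Asymptotics.isLittleO_iff]
  refine forall₂_congr fun ε _ => ?_
  rw [eventually_prod_iff]
  constructor
  · rintro ⟨pa, ha, pb, hb, h⟩
    obtain ⟨K, hK⟩ := eventually_atBot.1 hb
    refine ⟨min K (-1), by simp, ha.mono fun t ht k hk => ?_⟩
    have h1 := h ht (hK k (hk.trans (min_le_left _ _)))
    have h2 : (k : ℝ) ≤ 0 := by exact_mod_cast (by omega : k ≤ 0)
    simpa [abs_of_nonpos h2] using h1
  · rintro ⟨K, hK, h⟩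
    refine ⟨_, h, fun k => k ≤ K, eventually_le_atBot K, fun ht k hk => ?_⟩
    have h2 : (k : ℝ) ≤ 0 := by exact_mod_cast (by omega : k ≤ 0)
    simpa [abs_of_nonpos h2] using ht k hk

theorem HasSlope.add (h : HasSlope F W c) (h' : HasSlope F V d) :
    HasSlope F (fun t k => W t k + V t k) (c + d) :=
  (Asymptotics.IsLittleO.add h h').congr_left fun p => by simp only; ring

theorem HasSlope.sub (h : HasSlope F W c) (h' : HasSlope F V d) :
    HasSlope F (fun t k => W t k - V t k) (c - d) :=
  (Asymptotics.IsLittleO.sub h h').congr_left fun p => by simp only; ring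

theorem isLittleO_const_snd (F : Filter T) (a : ℝ) :
    (fun _ : T × ℤ => a) =o[F ×ˢ atBot] fun p => (p.2 : ℝ) := by
  refine Asymptotics.isLittleO_const_left.2 (Or.inr ?_)
  exact tendsto_abs_atBot_atTop.comp ((tendsto_intCast_atBot_iff.2 tendsto_id).comp tendsto_snd)

theorem HasSlope.sub_of_isBigO (h : HasSlope F W c) {f : T → ℝ}
    (hf : (fun t => f t) =O[F] fun _ => (1 : ℝ)) : HasSlope F (fun t k => W t k - f t) c := by
  have h1 : (fun p : T × ℤ => f p.1) =o[F ×ˢ atBot] fun p => (p.2 : ℝ) :=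
    (hf.comp_tendsto tendsto_fst).trans_isLittleO (isLittleO_const_snd F 1)
  exact (Asymptotics.IsLittleO.sub h h1).congr_left fun p => by simp only; ring

theorem HasSlope.pred (h : HasSlope F W c) : HasSlope F (fun t k => W t (k - 1)) c := by
  have ht : Tendsto (fun p : T × ℤ => (p.1, p.2 - 1)) (F ×ˢ atBot) (F ×ˢ atBot) :=
    tendsto_fst.prodMk ((tendsto_atBot_add_const_right _ (-1) tendsto_id).comp tendsto_snd)
  have h1 := Asymptotics.IsLittleO.comp_tendsto h ht
  have h2 : (fun p : T × ℤ => ((p.2 - 1 : ℤ) : ℝ)) =O[F ×ˢ atBot] fun p => (p.2 : ℝ) := by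
    push_cast
    exact (Asymptotics.isBigO_refl _ _).sub (isLittleO_const_snd F 1).isBigO
  have h3 := (h1.trans_isBigO h2).sub (isLittleO_const_snd F c)
  exact h3.congr_left fun p => by simp only [Function.comp]; push_cast; ring

theorem HasSlope.eventually_bddToLeft (h : HasSlope F W c) (hc : 0 < c) :
    ∀ᶠ t in F, BddToLeft (W t) := by
  obtain ⟨K, hK, h⟩ := hasSlope_iff.1 h c hc
  filter_upwards [h] with t ht
  refine bddToLeft_of_le (l := K) (u := 0) fun k hk => ?_
  linarith [(abs_le.1 (ht k hk)).2]

theorem HasSlope.runSup (h : HasSlope F W c) (hc : 0 < c) :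
    HasSlope F (fun t => runSup (W t)) c := by
  refine hasSlope_iff.2 fun ε hε => ?_
  -- Capping the error at `c` makes the upper bound `(c - min ε c) * k` nondecreasing in `k`, so
  -- over `k ≤ l` it is largest at `l`.
  obtain ⟨K, hK, h'⟩ := hasSlope_iff.1 h (min ε c) (lt_min hε hc)
  refine ⟨K, hK, ?_⟩
  filter_upwards [h', h.eventually_bddToLeft hc] with t ht hb l hl
  have hl0 : (l : ℝ) ≤ 0 := by exact_mod_cast (by omega : l ≤ 0)
  have h1 : min ε c * -(l : ℝ) ≤ ε * -l := by gcongr; linarith; exact min_le_left _ _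
  rw [abs_le]
  constructor
  · have := hb.le_runSup (le_refl l)
    linarith [(abs_le.1 (ht l hl)).1]
  · have : MultiQueue.runSup (W t) l ≤ c * l + min ε c * -l := by
      refine runSup_le fun k hk => ?_
      have h2 := (abs_le.1 (ht k (hk.trans hl))).2
      have h3 : (k : ℝ) ≤ l := by exact_mod_cast hk
      have h4 : (c - min ε c) * k ≤ (c - min ε c) * l :=
        mul_le_mul_of_nonneg_left h3 (sub_nonneg.2 (min_le_right _ _))
      linarith
    linarith

theorem HasSlope.tendsto_atBot {W : ℤ → ℝ} (h : HasSlope (pure ()) (fun _ => W) c) (hc : 0 < c) :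
    Tendsto W atBot atBot := by
  obtain ⟨K, hK, h'⟩ := hasSlope_iff.1 h (c / 2) (half_pos hc)
  rw [eventually_pure] at h'
  have h1 : Tendsto (fun k : ℤ => c / 2 * (k : ℝ)) atBot atBot :=
    (tendsto_intCast_atBot_iff.2 tendsto_id).const_mul_atBot (half_pos hc)
  refine tendsto_atBot_mono' _ ?_ h1
  filter_upwards [eventually_le_atBot K] with k hk
  linarith [(abs_le.1 (h' k hk)).2]

/-- A positive slope sends `W t` to `-∞` uniformly near `t₀`, so the running supremum is there a
maximum over one finite window. -/
theorem continuousAt_runSup [TopologicalSpace T] {t₀ : T} (h : HasSlope (𝓝 t₀) W c) (hc : 0 < c)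
    (hW : ∀ k, ContinuousAt (fun t => W t k) t₀) (l : ℤ) :
    ContinuousAt (fun t => MultiQueue.runSup (W t) l) t₀ := by
  obtain ⟨K, hK, h'⟩ := hasSlope_iff.1 h (c / 2) (half_pos hc)
  -- Below both `K` and `K'`, for `t` near `t₀`, one has `W t k ≤ (c / 2) * k < W t₀ l - 1 < W t l`,
  -- so such `k` cannot contribute.
  obtain ⟨K', hK'⟩ : ∃ K' : ℤ, ∀ k ≤ K', c / 2 * (k : ℝ) < W t₀ l - 1 :=
    eventually_atBot.1 <| ((tendsto_intCast_atBot_iff.2 tendsto_id).const_mul_atBot (half_pos hc)).eventually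
      (eventually_lt_atBot _)
  have hne : (Finset.Icc (min l (min K K')) l).Nonempty := ⟨l, by simp⟩
  have key : (fun t => (Finset.Icc (min l (min K K')) l).sup' hne fun k => W t k) =ᶠ[𝓝 t₀]
      fun t => MultiQueue.runSup (W t) l := by
    filter_upwards [h', h.eventually_bddToLeft hc,
      (hW l).eventually (lt_mem_nhds (sub_one_lt (W t₀ l)))] with t ht hb hl
    apply le_antisymm
    · exact Finset.sup'_le _ _ fun k hk => hb.le_runSup (Finset.mem_Icc.1 hk).2
    · refine runSup_le fun k hk => ?_
      rcases le_or_gt (min l (min K K')) k with h1 | h1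
      · exact Finset.le_sup' (fun k => W t k) (Finset.mem_Icc.2 ⟨h1, hk⟩)
      · have h2 : k ≤ K := by omega
        have h3 := hK' k (by omega)
        have h4 := (abs_le.1 (ht k h2)).2
        have h5 := Finset.le_sup' (fun k => W t k) (Finset.mem_Icc.2 ⟨min_le_left _ _, le_refl l⟩ :
          l ∈ Finset.Icc (min l (min K K')) l)
        linarith
  refine ContinuousAt.congr ?_ key
  exact ContinuousAt.finset_sup'_apply hne fun k _ => hW k

end Slope

/-! ### Sequences with averages, depending on a parameter -/

/-- A family of sequences that at `t₀` is continuous and has backward averages `a`, locally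
uniformly. -/
structure Regular {T : Type*} [TopologicalSpace T] (t₀ : T) (x : T → ℤ → ℝ) (a : ℝ) : Prop where
  cont : ∀ k, ContinuousAt (fun t => x t k) t₀
  slope : HasSlope (𝓝 t₀) (fun t => arrivalTime (x t)) a

section Regular

variable {T : Type*} [TopologicalSpace T] {t₀ : T} {I ω : T → ℤ → ℝ} {a b : ℝ}

theorem Regular.continuousAt_arrivalTime (h : Regular t₀ I a) (k : ℤ) :
    ContinuousAt (fun t => arrivalTime (I t) k) t₀ := by
  unfold arrivalTime
  exact (tendsto_finsetSum _ fun i _ => h.cont i).sub (tendsto_finsetSum _ fun i _ => h.cont i)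

theorem Regular.hasSlope_weight (hI : Regular t₀ I a) (hω : Regular t₀ ω b) :
    HasSlope (𝓝 t₀) (fun t => weight (I t) (ω t)) (a - b) :=
  hI.slope.sub hω.slope.pred

theorem Regular.eventually_stable (hI : Regular t₀ I a) (hω : Regular t₀ ω b) (hab : b < a) :
    ∀ᶠ t in 𝓝 t₀, Stable (I t) (ω t) :=
  (hI.hasSlope_weight hω).eventually_bddToLeft (sub_pos.2 hab)

theorem Regular.continuousAt_departureTime (hI : Regular t₀ I a) (hω : Regular t₀ ω b)
    (hab : b < a) (l : ℤ) : ContinuousAt (fun t => departureTime (I t) (ω t) l) t₀ := by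
  have h := (hω.continuousAt_arrivalTime l).add <|
    continuousAt_runSup (hI.hasSlope_weight hω) (sub_pos.2 hab)
      (fun k => (hI.continuousAt_arrivalTime k).sub (hω.continuousAt_arrivalTime (k - 1))) l
  refine h.congr ?_
  filter_upwards [hI.eventually_stable hω hab] with t ht
  exact (ht.departureTime_eq l).symm

/-- Departure times are the service sums, of slope `b`, plus a running supremum that keeps the slope
`a - b` of its weight; the total is `a`. The output is therefore again admissible as arrivals for
the next queue. -/
theorem Regular.queueMap (hI : Regular t₀ I a) (hω : Regular t₀ ω b) (hab : b < a) :
    Regular t₀ (fun t => queueMap (I t) (ω t)) a where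
  cont k := (hI.continuousAt_departureTime hω hab k).sub
    (hI.continuousAt_departureTime hω hab (k - 1))
  slope := by
    have h1 := hω.slope.add ((hI.hasSlope_weight hω).runSup (sub_pos.2 hab))
    rw [add_sub_cancel] at h1
    have h2 : HasSlope (𝓝 t₀) (fun t => departureTime (I t) (ω t)) a := by
      refine Asymptotics.IsLittleO.congr' h1 ?_ (EventuallyEq.refl _ _)
      have := (hI.eventually_stable hω hab).prod_inl (atBot : Filter ℤ)
      filter_upwards [this] with p hp
      simp only [hp.departureTime_eq]
    have h3 := h2.sub_of_isBigO ((hI.continuousAt_departureTime hω hab 0).isBigO_one ℝ)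
    exact Asymptotics.IsLittleO.congr_left h3 fun p => by simp only [arrivalTime_queueMap]

end Regular

/-! ### Averages of single sequences -/

/-- The backward averages of `x` converge to `a`. -/
def HasAvg (x : ℤ → ℝ) (a : ℝ) : Prop := Regular () (fun _ => x) a

section HasAvg

variable {x I ω A B C : ℤ → ℝ} {a b c : ℝ}

theorem hasAvg_iff : HasAvg x a ↔ HasSlope (pure ()) (fun _ => arrivalTime x) a := by
  have : 𝓝 () = pure () := by simp
  constructor
  · exact fun h => this ▸ h.slope
  · exact fun h => ⟨fun _ => continuousAt_const, this ▸ h⟩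

theorem HasAvg.stable (hI : HasAvg I a) (hω : HasAvg ω b) (hab : b < a) : Stable I ω :=
  (Regular.eventually_stable hI hω hab).self_of_nhds

theorem HasAvg.queueMap (hI : HasAvg I a) (hω : HasAvg ω b) (hab : b < a) :
    HasAvg (queueMap I ω) a :=
  Regular.queueMap hI hω hab

theorem arrivalTime_sub_arrivalTime (x y : ℤ → ℝ) (k : ℤ) :
    arrivalTime (fun k => x k - y k) k = arrivalTime x k - arrivalTime y k := by
  simp only [arrivalTime, Finset.sum_sub_distrib]; ring

theorem arrivalTime_add_arrivalTime (x y : ℤ → ℝ) (k : ℤ) :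
    arrivalTime (fun k => x k + y k) k = arrivalTime x k + arrivalTime y k := by
  simp only [arrivalTime, Finset.sum_add_distrib]; ring

/-- The conservation law `dualService_add_queueMap` gives the slope `a + b - a`. -/
theorem HasAvg.dualService (hI : HasAvg I a) (hω : HasAvg ω b) (hab : b < a) :
    HasAvg (dualService I ω) b := by
  have h1 := (hI.slope.add hω.slope).sub (hI.queueMap hω hab).slope
  rw [add_sub_cancel_left] at h1
  refine hasAvg_iff.2 ?_
  have : 𝓝 () = pure () := by simp
  rw [← this]
  refine Asymptotics.IsLittleO.congr_left h1 fun p => ?_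
  simp only [← arrivalTime_add_arrivalTime, ← arrivalTime_sub_arrivalTime]
  have h : MultiQueue.dualService I ω = fun k => I k + ω k - MultiQueue.queueMap I ω k := by
    ext k
    have := (hI.stable hω hab).dualService_add_queueMap k
    linarith
  rw [h]

theorem HasAvg.tendsto_sub (hI : HasAvg I a) (hω : HasAvg ω b) (hab : b < a) :
    Tendsto (fun k => arrivalTime I k - arrivalTime ω k) atBot atBot :=
  HasSlope.tendsto_atBot ((hasAvg_iff.1 hI).sub (hasAvg_iff.1 hω)) (sub_pos.2 hab)

/-- The interchange identity for sequences with decreasing averages. -/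
theorem HasAvg.queueMap_queueMap (hA : HasAvg A a) (hB : HasAvg B b) (hC : HasAvg C c)
    (hba : b < a) (hcb : c < b) :
    MultiQueue.queueMap (MultiQueue.queueMap A B) C =
      MultiQueue.queueMap (MultiQueue.queueMap A (MultiQueue.dualService B C))
        (MultiQueue.queueMap B C) :=
  MultiQueue.queueMap_queueMap (hA.stable hB hba) ((hA.queueMap hB hba).stable hC (hcb.trans hba))
    (hB.stable hC hcb) (hA.stable (hB.dualService hC hcb) (hcb.trans hba))
    ((hA.queueMap (hB.dualService hC hcb) (hcb.trans hba)).stable (hB.queueMap hC hcb) hba)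

theorem backwardAvg_eq (x : ℤ → ℝ) (N : ℕ) :
    backwardAvg x N = -arrivalTime x (-N - 1) / N := by
  rw [backwardAvg, sum_Icc_eq_arrivalTime_sub x (by omega), arrivalTime_zero, zero_sub]

theorem tendsto_succ_div : Tendsto (fun N : ℕ => ((N : ℝ) + 1) / N) atTop (𝓝 1) := by
  have := (tendsto_const_nhds (x := (1 : ℝ))).add (tendsto_one_div_atTop_nhds_zero_nat (𝕜 := ℝ))
  rw [add_zero] at this
  refine this.congr' ?_
  filter_upwards [eventually_ne_atTop 0] with N hN
  have : (N : ℝ) ≠ 0 := by exact_mod_cast hN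
  field_simp

/-- The average with index `N` divides `N + 1` terms by `N` and involves `arrivalTime` at `-N - 1`;
the two normalizations differ by the factor `(N + 1) / N`. -/
theorem hasAvg_iff_tendsto_backwardAvg :
    HasAvg x a ↔ Tendsto (backwardAvg x) atTop (𝓝 a) := by
  have hne : ∀ᶠ k : ℤ in atBot, (k : ℝ) ≠ 0 := by
    filter_upwards [eventually_lt_atBot 0] with k hk
    exact_mod_cast hk.ne
  have h1 : HasAvg x a ↔ Tendsto (fun k : ℤ => arrivalTime x k / k) atBot (𝓝 a) := by
    rw [hasAvg_iff, HasSlope, pure_prod, Asymptotics.isLittleO_map]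
    change (fun k : ℤ => arrivalTime x k - a * k) =o[atBot] (fun k : ℤ => (k : ℝ)) ↔ _
    rw [Asymptotics.isLittleO_iff_tendsto' (hne.mono fun k hk h => absurd h hk)]
    refine Iff.trans ?_ tendsto_sub_nhds_zero_iff
    refine tendsto_congr' (hne.mono fun k hk => ?_)
    field_simp
  have h2 : map (fun N : ℕ => -(N : ℤ) - 1) atTop = atBot := by
    have : (fun N : ℕ => -(N : ℤ) - 1) = (fun k => k - 1) ∘ Neg.neg ∘ Nat.cast := rfl
    rw [this, ← map_map, ← map_map, Nat.map_cast_int_atTop, map_neg_atTop]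
    exact (OrderIso.subRight (1 : ℤ)).map_atBot
  rw [h1, ← h2, tendsto_map'_iff]
  have h3 := tendsto_succ_div
  constructor
  · intro h
    have := h.mul h3
    rw [mul_one] at this
    refine this.congr' ?_
    filter_upwards [eventually_ne_atTop 0] with N hN
    have h4 : (N : ℝ) ≠ 0 := by exact_mod_cast hN
    have h5 : -(N : ℝ) - 1 ≠ 0 := by have := N.cast_nonneg (α := ℝ); linarith
    simp only [Function.comp, backwardAvg_eq]
    push_cast
    rw [div_mul_div_comm, div_eq_div_iff (by positivity) h4]
    ring
  · intro h
    have := h.div h3 one_ne_zero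
    rw [div_one] at this
    refine this.congr' ?_
    filter_upwards [eventually_ne_atTop 0] with N hN
    have h4 : (N : ℝ) ≠ 0 := by exact_mod_cast hN
    have h5 : -(N : ℝ) - 1 ≠ 0 := by have := N.cast_nonneg (α := ℝ); linarith
    have h6 : (N : ℝ) + 1 ≠ 0 := by positivity
    simp only [Function.comp, Pi.div_apply, backwardAvg_eq]
    push_cast
    rw [div_div_div_cancel_right₀ h4, div_eq_div_iff h6 h5]
    ring

end HasAvg

/-! ### The joint map, one service at a time -/

/-- The tuple `(D(η^1, x), …, D(η^n, x))`. -/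
def queueAll {n : ℕ} (x : ℤ → ℝ) (η : Seqs n) : Seqs n := fun i => queueMap (η i) x

/-- The step `(x, η) ↦ (x, D(η^1, x), …, D(η^n, x))` of the recursion for `jointMap`. -/
def queueStep {n : ℕ} (x : ℤ → ℝ) (η : Seqs n) : Seqs (n + 1) :=
  Fin.cons x (queueAll x η)

/-- Every output except the first ends with the service `I 0`, and what precedes it is the joint map
of the remaining sequences. All inductions on the number of sequences rest on this recursion. -/
theorem jointMap_succ {n : ℕ} (I : Seqs (n + 1)) :
    jointMap (n + 1) I = queueStep (I 0) (jointMap n (Fin.tail I)) := by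
  funext i
  refine Fin.cases ?_ (fun j => ?_) i
  · rfl
  · simp only [queueStep, Fin.cons_succ, queueAll]
    change queueMap (multiQueueMap j fun t => _) _ = _
    congr 1
    · simp only [jointMap]
      congr 1
      funext t
      simp only [Fin.tail]
      congr 1
      ext
      have := t.isLt
      simp
      omega
    · ext
      simp

theorem jointMap_cons {n : ℕ} (x : ℤ → ℝ) (I : Seqs n) :
    jointMap (n + 1) (Fin.cons x I) = queueStep x (jointMap n I) := by
  rw [jointMap_succ, Fin.cons_zero, Fin.tail_cons]

theorem StrictMono.fin_tail {n : ℕ} {a : Fin (n + 1) → ℝ} (h : StrictMono a) :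
    StrictMono (Fin.tail a) :=
  h.comp Fin.strictMono_succ

theorem regular_jointMap {T : Type*} [TopologicalSpace T] {t₀ : T} {n : ℕ} {I : T → Seqs n}
    {a : Fin n → ℝ} (hI : ∀ i, Regular t₀ (fun t => I t i) (a i)) (ha : StrictMono a) (i : Fin n) :
    Regular t₀ (fun t => jointMap n (I t) i) (a i) := by
  induction n with
  | zero => exact i.elim0
  | succ n ih =>
    simp only [jointMap_succ]
    refine Fin.cases ?_ (fun j => ?_) i
    · exact hI 0
    · exact (ih (fun i => hI i.succ) (StrictMono.fin_tail ha) j).queueMap (hI 0)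
        (ha (Fin.succ_pos j))

theorem hasAvg_jointMap {n : ℕ} {I : Seqs n} {a : Fin n → ℝ} (hI : ∀ i, HasAvg (I i) (a i))
    (ha : StrictMono a) (i : Fin n) : HasAvg (jointMap n I i) (a i) :=
  regular_jointMap (T := Unit) (I := fun _ => I) hI ha i

/-- The first comparison holds because interdeparture times dominate service times; the others
survive the common last service by `queueMap_mono`. -/
theorem jointMap_nonneg_and_le {n : ℕ} {I : Seqs n} {a : Fin n → ℝ} (h0 : ∀ i k, 0 ≤ I i k)
    (hI : ∀ i, HasAvg (I i) (a i)) (ha : StrictMono a) :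
    (∀ i k, 0 ≤ jointMap n I i k) ∧
      ∀ i j : Fin n, (i : ℕ) + 1 = j → ∀ k, jointMap n I i k ≤ jointMap n I j k := by
  induction n with
  | zero => exact ⟨fun i => i.elim0, fun i => i.elim0⟩
  | succ n ih =>
    have ha' := StrictMono.fin_tail ha
    obtain ⟨ih0, ih1⟩ := ih (I := Fin.tail I) (fun i => h0 i.succ) (fun i => hI i.succ) ha'
    have hs (i : Fin n) : Stable (jointMap n (Fin.tail I) i) (I 0) :=
      (hasAvg_jointMap (I := Fin.tail I) (fun i => hI i.succ) ha' i).stable (hI 0)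
        (ha (Fin.succ_pos i))
    simp only [jointMap_succ]
    constructor
    · refine Fin.cases (h0 0) fun i k => ?_
      exact (h0 0 k).trans ((hs i).le_queueMap k)
    · intro i j hij k
      obtain ⟨j, rfl⟩ := Fin.exists_succ_eq.2 (show j ≠ 0 by rintro rfl; simp at hij)
      revert hij
      refine Fin.cases (fun _ => ?_) (fun i hij => ?_) i
      · exact (hs j).le_queueMap k
      · exact queueMap_mono (hs i) (hs j) (ih1 i j (by simpa using hij)) k

theorem jointMap_mem_outputSpace {n : ℕ} {I : Seqs n} (hI : I ∈ arrivalSpace n) :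
    jointMap n I ∈ outputSpace n := by
  obtain ⟨h0, a, hI, hpos, ha⟩ := hI
  have hI' (i : Fin n) : HasAvg (I i) (a i) := hasAvg_iff_tendsto_backwardAvg.2 (hI i)
  obtain ⟨h1, h2⟩ := jointMap_nonneg_and_le h0 hI' ha
  refine ⟨h1, h2, fun i _ => ?_⟩
  have h3 := hasAvg_iff_tendsto_backwardAvg.1 (hasAvg_jointMap hI' ha i)
  have h4 := ((continuous_coe_real_ereal.tendsto (a i)).comp h3).liminf_eq
  simp only [Function.comp_def] at h4
  rw [h4]
  exact_mod_cast hpos i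

/-! ### Measurability and translations -/

theorem measurable_arrivalTime (k : ℤ) : Measurable fun I : ℤ → ℝ => arrivalTime I k := by
  unfold arrivalTime
  fun_prop

theorem measurable_departureTime (l : ℤ) :
    Measurable fun p : (ℤ → ℝ) × (ℤ → ℝ) => departureTime p.1 p.2 l := by
  unfold departureTime
  refine Measurable.iSup fun k => ?_
  exact ((measurable_arrivalTime k).comp measurable_fst).add (by fun_prop)

theorem measurable_queueMap :
    Measurable fun p : (ℤ → ℝ) × (ℤ → ℝ) => queueMap p.1 p.2 :=
  measurable_pi_lambda _ fun l => (measurable_departureTime l).sub (measurable_departureTime (l - 1))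

theorem _root_.Measurable.queueMap {α : Type*} [MeasurableSpace α] {f g : α → ℤ → ℝ}
    (hf : Measurable f) (hg : Measurable g) :
    Measurable fun a => MultiQueue.queueMap (f a) (g a) := by
  have := measurable_queueMap.comp (hf.prodMk hg)
  simp only [Function.comp_def] at this
  exact this

theorem measurable_dualService :
    Measurable fun p : (ℤ → ℝ) × (ℤ → ℝ) => dualService p.1 p.2 := by
  refine measurable_pi_lambda _ fun l => Measurable.min (by fun_prop) ?_
  exact (measurable_departureTime (l - 1)).sub ((measurable_arrivalTime (l - 1)).comp measurable_fst)

theorem measurable_queueAll (n : ℕ) :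
    Measurable fun p : (ℤ → ℝ) × Seqs n => queueAll p.1 p.2 := by
  exact measurable_pi_iff.2 fun i =>
    Measurable.queueMap (measurable_pi_iff.1 measurable_snd i) measurable_fst

theorem measurable_cons (n : ℕ) :
    Measurable fun p : (ℤ → ℝ) × Seqs n => (Fin.cons p.1 p.2 : Seqs (n + 1)) := by
  refine measurable_pi_lambda _ fun i => ?_
  refine Fin.cases ?_ (fun j => ?_) i
  · simpa using measurable_fst
  · simpa using measurable_pi_iff.1 measurable_snd j

theorem measurable_queueStep (n : ℕ) :
    Measurable fun p : (ℤ → ℝ) × Seqs n => queueStep p.1 p.2 :=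
  (measurable_cons n).comp (measurable_fst.prodMk (measurable_queueAll n))

theorem measurable_jointMap (n : ℕ) : Measurable (jointMap n) := by
  induction n with
  | zero => exact measurable_of_subsingleton_codomain _
  | succ n ih =>
    have : jointMap (n + 1) = (fun p : (ℤ → ℝ) × Seqs n => queueStep p.1 p.2) ∘
        fun I => (I 0, jointMap n (Fin.tail I)) := funext jointMap_succ
    rw [this]
    refine (measurable_queueStep n).comp ((measurable_pi_apply 0).prodMk (ih.comp ?_))
    exact measurable_pi_lambda _ fun i => measurable_pi_apply _

theorem measurable_shift {n : ℕ} (l : ℤ) : Measurable (shift (n := n) l) :=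
  measurable_pi_lambda _ fun i => measurable_pi_lambda _ fun k =>
    (measurable_pi_apply (k + l)).comp (measurable_pi_apply i)

theorem jointMap_shift {n : ℕ} (l : ℤ) (I : Seqs n) :
    jointMap n (shift l I) = shift l (jointMap n I) := by
  induction n with
  | zero => exact Subsingleton.elim _ _
  | succ n ih =>
    rw [jointMap_succ, jointMap_succ]
    have h : Fin.tail (shift l I) = shift l (Fin.tail I) := rfl
    rw [h, ih]
    funext i
    refine Fin.cases rfl (fun j => ?_) i
    funext k
    exact queueMap_shift _ _ l k

/-! ### Rearrangements of product measures -/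

section Rearrange

variable {α β γ δ : Type*} [MeasurableSpace α] [MeasurableSpace β] [MeasurableSpace γ]
  [MeasurableSpace δ]

theorem measurePreserving_leftComm (μ : Measure α) (ν : Measure β) (τ : Measure γ) [SFinite μ]
    [SFinite ν] [SFinite τ] :
    MeasurePreserving (fun p : α × β × γ => (p.2.1, p.1, p.2.2)) (μ.prod (ν.prod τ))
      (ν.prod (μ.prod τ)) :=
  (measurePreserving_prodAssoc ν μ τ).comp
    ((Measure.measurePreserving_swap.prod (MeasurePreserving.id τ)).comp
      ((measurePreserving_prodAssoc μ ν τ).symm _))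

theorem measurePreserving_prodProdProdComm (μ : Measure α) (ν : Measure β) (τ : Measure γ)
    (υ : Measure δ) [SFinite μ] [SFinite ν] [SFinite τ] [SFinite υ] :
    MeasurePreserving (fun p : (α × β) × γ × δ => ((p.1.1, p.2.1), (p.1.2, p.2.2)))
      ((μ.prod ν).prod (τ.prod υ)) ((μ.prod τ).prod (ν.prod υ)) :=
  ((measurePreserving_prodAssoc μ τ (ν.prod υ)).symm _).comp
    (((MeasurePreserving.id μ).prod (measurePreserving_leftComm ν τ υ)).comp
      (measurePreserving_prodAssoc μ ν (τ.prod υ)))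

theorem MeasurePreserving.withDensity {μ : Measure α} {f : α → α} (hf : MeasurePreserving f μ μ)
    {ρ : α → ENNReal} (hρ : Measurable ρ) (h : ∀ x, ρ (f x) = ρ x) :
    MeasurePreserving f (μ.withDensity ρ) (μ.withDensity ρ) := by
  refine ⟨hf.measurable, ?_⟩
  ext s hs
  rw [Measure.map_apply hf.measurable hs, withDensity_apply _ (hf.measurable hs),
    withDensity_apply _ hs, ← hf.setLIntegral_comp_preimage hs hρ]
  simp only [h]

end Rearrange

/-- Overwriting a coordinate by an independent copy keeps the law. Read backwards, this splits
coordinate `k` off the family, so that a single customer can be treated separately. -/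
theorem measurePreserving_update_infinitePi {ι : Type*} [DecidableEq ι] {X : Type*} [MeasurableSpace X]
    (μ : Measure X) [IsProbabilityMeasure μ] (k : ι) :
    MeasurePreserving (fun p : X × (ι → X) => Function.update p.2 k p.1)
      (μ.prod (Measure.infinitePi fun _ => μ)) (Measure.infinitePi fun _ => μ) := by
  have hm : Measurable fun p : X × (ι → X) => Function.update p.2 k p.1 := by
    refine measurable_pi_iff.2 fun i => ?_
    by_cases h : i = k
    · subst h; simpa using measurable_fst
    · simpa [h] using measurable_pi_iff.1 measurable_snd i
  refine ⟨hm, ?_⟩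
  refine Measure.eq_infinitePi _ fun s t ht => ?_
  rw [Measure.map_apply hm (.pi s.countable_toSet fun i _ => ht i)]
  by_cases hk : k ∈ s
  · have : (fun p : X × (ι → X) => Function.update p.2 k p.1) ⁻¹' (s : Set ι).pi t =
        t k ×ˢ ((s.erase k : Finset ι) : Set ι).pi t := by
      ext ⟨x, y⟩
      simp only [Set.mem_preimage, Set.mem_pi, Set.mem_prod, Finset.mem_coe, Finset.mem_erase]
      constructor
      · intro h
        refine ⟨by simpa using h k hk, fun i hi => ?_⟩
        simpa [hi.1] using h i hi.2
      · rintro ⟨h1, h2⟩ i hi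
        by_cases hik : i = k
        · subst hik; simpa using h1
        · simpa [hik] using h2 i ⟨hik, hi⟩
    rw [this, Measure.prod_prod, Measure.infinitePi_pi _ fun i _ => ht i,
      Finset.mul_prod_erase s (fun i => μ (t i)) hk]
  · have : (fun p : X × (ι → X) => Function.update p.2 k p.1) ⁻¹' (s : Set ι).pi t =
        Set.univ ×ˢ (s : Set ι).pi t := by
      ext ⟨x, y⟩
      simp only [Set.mem_preimage, Set.mem_pi, Set.mem_prod, Finset.mem_coe, Set.mem_univ, true_and]
      refine forall₂_congr fun i hi => ?_
      have : i ≠ k := by rintro rfl; exact hk hi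
      simp [this]
    rw [this, Measure.prod_prod, Measure.infinitePi_pi _ fun i _ => ht i, measure_univ, one_mul]

/-! ### Exponential variables -/

theorem expMeasure_eq_withDensity (r : ℝ) :
    expMeasure r = volume.withDensity (exponentialPDF r) := rfl

theorem measurable_exponentialPDF (r : ℝ) : Measurable (exponentialPDF r) :=
  (measurable_exponentialPDFReal r).ennreal_ofReal

theorem ae_nonneg_expMeasure (r : ℝ) : ∀ᵐ x ∂expMeasure r, 0 ≤ x := by
  rw [ae_iff, expMeasure_eq_withDensity]
  have : {x : ℝ | ¬ 0 ≤ x} = Set.Iio 0 := by ext; simp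
  rw [this, withDensity_apply _ measurableSet_Iio, lintegral_exponentialPDF_of_nonpos le_rfl]

theorem lintegral_ofReal_expMeasure {r : ℝ} (hr : 0 < r) :
    ∫⁻ x, ENNReal.ofReal x ∂expMeasure r = ENNReal.ofReal r⁻¹ := by
  rw [expMeasure_eq_withDensity,
    lintegral_withDensity_eq_lintegral_mul _ (measurable_exponentialPDF r) (by fun_prop)]
  -- Up to the factor `r⁻¹`, the integrand is the Gamma density of shape 2, which integrates to one.
  have h : ∀ x, (exponentialPDF r * fun x => ENNReal.ofReal x) x =
      ENNReal.ofReal r⁻¹ * gammaPDF 2 r x := by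
    intro x
    rw [Pi.mul_apply]
    rcases lt_or_ge x 0 with hx | hx
    · rw [gammaPDF_of_neg hx, exponentialPDF_of_neg hx]; simp
    · rw [gammaPDF_of_nonneg hx, exponentialPDF_of_nonneg hx, ← ENNReal.ofReal_mul (by positivity),
        ← ENNReal.ofReal_mul (by positivity)]
      congr 1
      have : Real.Gamma 2 = 1 := by simp
      rw [this, show (2 : ℝ) - 1 = 1 by norm_num, Real.rpow_one, Real.rpow_two]
      field_simp
  rw [lintegral_congr h, lintegral_const_mul' _ _ ENNReal.ofReal_ne_top,
    lintegral_gammaPDF_eq_one two_pos hr, mul_one]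

theorem integrable_id_expMeasure {r : ℝ} (hr : 0 < r) : Integrable (fun x => x) (expMeasure r) := by
  refine ⟨by fun_prop, ?_⟩
  rw [hasFiniteIntegral_iff_ofReal (ae_nonneg_expMeasure r), lintegral_ofReal_expMeasure hr]
  exact ENNReal.ofReal_lt_top

theorem integral_id_expMeasure {r : ℝ} (hr : 0 < r) : ∫ x, x ∂expMeasure r = r⁻¹ := by
  rw [integral_eq_lintegral_of_nonneg_ae (ae_nonneg_expMeasure r) (by fun_prop),
    lintegral_ofReal_expMeasure hr, ENNReal.toReal_ofReal (by positivity)]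

theorem map_mul_expMeasure {c : ℝ} (hc : 0 < c) :
    (expMeasure 1).map (fun x => c * x) = expMeasure c⁻¹ := by
  have := isProbabilityMeasure_expMeasure one_pos
  have := isProbabilityMeasure_expMeasure (inv_pos.2 hc)
  have : IsProbabilityMeasure ((expMeasure 1).map fun x => c * x) :=
    Measure.isProbabilityMeasure_map (by fun_prop)
  refine Measure.eq_of_cdf _ _ ?_
  ext x
  rw [cdf_expMeasure_eq (inv_pos.2 hc), cdf_eq_real, map_measureReal_apply (by fun_prop)
    measurableSet_Iic]
  have : (fun x => c * x) ⁻¹' Set.Iic x = Set.Iic (x / c) := by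
    ext y; simp [le_div_iff₀ hc, mul_comm]
  rw [this, ← cdf_eq_real, cdf_expMeasure_eq one_pos]
  have h : 0 ≤ x / c ↔ 0 ≤ x := by rw [le_div_iff₀ hc, zero_mul]
  simp only [h, one_mul, inv_mul_eq_div]

/-! ### One service -/

/-- One service: the sojourn time, interarrival time and service time `(J, I, ω)` become the next
sojourn time, the interdeparture time and the dual service time. -/
def serve (p : ℝ × ℝ × ℝ) : ℝ × ℝ × ℝ :=
  (p.2.2 + max 0 (p.1 - p.2.1), p.2.2 + max 0 (p.2.1 - p.1), min p.2.1 p.1)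

/-- In the coordinate `v = x - z` a service fixes `v` and sends `(z, w)` to `(w - min v 0, z + min v
0)`, a swap followed by a translation depending on `v`. The changes of coordinates are shears. -/
theorem measurePreserving_serve_volume : MeasurePreserving serve volume volume := by
  have h1 : MeasurePreserving (fun p : ℝ × ℝ × ℝ => (p.1, (p.2.1 - p.1, p.2.2))) volume volume := by
    refine MeasurePreserving.skew_product (g := fun z (q : ℝ × ℝ) => (q.1 - z, q.2))
      (MeasurePreserving.id volume) (by unfold Function.uncurry; fun_prop) (ae_of_all _ fun z => ?_)
    exact ((measurePreserving_sub_right volume z).prod (MeasurePreserving.id volume)).map_eq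
  have h2 : MeasurePreserving
      (fun p : ℝ × ℝ × ℝ => (p.1, (p.2.2 + -min p.1 0, p.2.1 + min p.1 0))) volume volume := by
    refine MeasurePreserving.skew_product
      (g := fun v (q : ℝ × ℝ) => (q.2 + -min v 0, q.1 + min v 0))
      (MeasurePreserving.id volume) (by unfold Function.uncurry; fun_prop) (ae_of_all _ fun v => ?_)
    exact (((measurePreserving_add_right volume _).prod (measurePreserving_add_right volume _)).comp
      Measure.measurePreserving_swap).map_eq
  have h3 : MeasurePreserving (fun p : ℝ × ℝ × ℝ => (p.1, (p.2.1 + p.1, p.2.2))) volume volume := by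
    refine MeasurePreserving.skew_product (g := fun z (q : ℝ × ℝ) => (q.1 + z, q.2))
      (MeasurePreserving.id volume) (by unfold Function.uncurry; fun_prop) (ae_of_all _ fun z => ?_)
    exact ((measurePreserving_add_right volume z).prod (MeasurePreserving.id volume)).map_eq
  have h4 := measurePreserving_leftComm (volume : Measure ℝ) (volume : Measure ℝ)
    (volume : Measure ℝ)
  have h5 := h3.comp (h4.comp (h2.comp (h4.comp h1)))
  convert h5 using 1
  funext ⟨z, x, w⟩
  simp only [serve, Function.comp]
  rcases le_total x z with h | h
  · rw [max_eq_right (by linarith : 0 ≤ z - x), max_eq_left (by linarith : x - z ≤ 0),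
      min_eq_left h, min_eq_left (by linarith : x - z ≤ 0)]
    ext <;> (simp; try ring)
  · rw [max_eq_left (by linarith : z - x ≤ 0), max_eq_right (by linarith : 0 ≤ x - z),
      min_eq_right h, min_eq_right (by linarith : 0 ≤ x - z)]
    ext <;> (simp; try ring)

theorem measurable_serve : Measurable serve := measurePreserving_serve_volume.measurable

/-- The one-step Burke property. -/
theorem measurePreserving_serve {β γ : ℝ} (hβ : 0 < β) (hγ : 0 < γ) :
    MeasurePreserving serve
      ((expMeasure γ).prod ((expMeasure β).prod (expMeasure (γ + β))))
      ((expMeasure γ).prod ((expMeasure β).prod (expMeasure (γ + β)))) := by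
  have hm := measurable_exponentialPDF
  have h : (expMeasure γ).prod ((expMeasure β).prod (expMeasure (γ + β))) =
      (volume : Measure (ℝ × ℝ × ℝ)).withDensity fun p =>
        exponentialPDF γ p.1 * (exponentialPDF β p.2.1 * exponentialPDF (γ + β) p.2.2) := by
    have h1 : SFinite (volume.withDensity (exponentialPDF γ)) := inferInstance
    simp only [expMeasure_eq_withDensity]
    rw [prod_withDensity (hm _) (hm _), prod_withDensity (hm _) (by fun_prop)]
    rfl
  rw [h]
  refine MeasurePreserving.withDensity measurePreserving_serve_volume (by fun_prop) ?_
  rintro ⟨z, x, w⟩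
  simp only [serve]
  by_cases hp : 0 ≤ z ∧ 0 ≤ x ∧ 0 ≤ w
  · obtain ⟨hz, hx, hw⟩ := hp
    have h1 : 0 ≤ w + max 0 (z - x) := by positivity
    have h2 : 0 ≤ w + max 0 (x - z) := by positivity
    have h3 : 0 ≤ min x z := le_min hx hz
    simp only [exponentialPDF_of_nonneg, hz, hx, hw, h1, h2, h3]
    rw [← ENNReal.ofReal_mul (by positivity), ← ENNReal.ofReal_mul (by positivity),
      ← ENNReal.ofReal_mul (by positivity), ← ENNReal.ofReal_mul (by positivity)]
    congr 1
    -- The exponent is `γ (u + t) + β (v + t)` up to sign. A service conserves both the sum of the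
    -- first and third entries and that of the second and third; the service rate `γ + β` is what
    -- makes the exponent depend on these sums alone.
    have e : ∀ u v t : ℝ, γ * Real.exp (-(γ * u)) * (β * Real.exp (-(β * v)) *
        ((γ + β) * Real.exp (-((γ + β) * t)))) =
        γ * β * (γ + β) * Real.exp (-(γ * u) + -(β * v) + -((γ + β) * t)) := by
      intro u v t; rw [Real.exp_add, Real.exp_add]; ring
    rw [e, e]
    congr 2
    rcases le_total x z with h | h
    · rw [max_eq_right (by linarith : 0 ≤ z - x), max_eq_left (by linarith : x - z ≤ 0),
        min_eq_left h]; ring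
    · rw [max_eq_left (by linarith : z - x ≤ 0), max_eq_right (by linarith : 0 ≤ x - z),
        min_eq_right h]; ring
  -- Outside the nonnegative octant both densities vanish: nonnegative outputs force nonnegative
  -- inputs, since `min x z ≥ 0` bounds `x` and `z`, and `w` is one of the first two outputs.
  · have h0 : exponentialPDF γ z * (exponentialPDF β x * exponentialPDF (γ + β) w) = 0 := by
      by_contra hne
      simp only [mul_eq_zero, not_or] at hne
      refine hp ⟨?_, ?_, ?_⟩ <;> by_contra! hlt
      · exact hne.1 (exponentialPDF_of_neg hlt)
      · exact hne.2.1 (exponentialPDF_of_neg hlt)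
      · exact hne.2.2 (exponentialPDF_of_neg hlt)
    rw [h0]
    by_contra hne
    simp only [mul_eq_zero, not_or] at hne
    have h1 : 0 ≤ w + max 0 (z - x) := by
      by_contra! hlt; exact hne.1 (exponentialPDF_of_neg hlt)
    have h2 : 0 ≤ w + max 0 (x - z) := by
      by_contra! hlt; exact hne.2.1 (exponentialPDF_of_neg hlt)
    have h3 : 0 ≤ min x z := by
      by_contra! hlt; exact hne.2.2 (exponentialPDF_of_neg hlt)
    rw [le_min_iff] at h3
    refine hp ⟨h3.2, h3.1, ?_⟩
    rcases le_total x z with h | h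
    · rwa [max_eq_left (by linarith : x - z ≤ 0), add_zero] at h2
    · rwa [max_eq_left (by linarith : z - x ≤ 0), add_zero] at h1

/-! ### The law of large numbers -/

theorem ae_hasAvg_infinitePi (μ : Measure ℝ) [IsProbabilityMeasure μ]
    (hμ : Integrable (fun x => x) μ) :
    ∀ᵐ x ∂Measure.infinitePi (fun _ : ℤ => μ), HasAvg x (∫ y, y ∂μ) := by
  set P := Measure.infinitePi (fun _ : ℤ => μ)
  have hev (k : ℤ) : MeasurePreserving (fun x : ℤ → ℝ => x k) P μ :=
    measurePreserving_eval_infinitePi _ k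
  have hind : iIndepFun (fun (k : ℤ) (x : ℤ → ℝ) => x k) P :=
    iIndepFun_infinitePi (P := fun _ : ℤ => μ) (X := fun _ x => x) fun _ => measurable_id
  have hslln := strong_law_ae_real (μ := P) (fun (n : ℕ) (x : ℤ → ℝ) => x (-n))
    ((hev _).integrable_comp_of_integrable hμ)
    (fun i j hij => hind.indepFun (by simpa using hij))
    (fun i => ⟨(hev _).measurable.aemeasurable, (hev _).measurable.aemeasurable,
      (hev _).map_eq.trans (hev _).map_eq.symm⟩)
  have hint : ∫ x, x (-((0 : ℕ) : ℤ)) ∂P = ∫ y, y ∂μ := by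
    rw [← (hev (-((0 : ℕ) : ℤ))).map_eq, integral_map (hev _).measurable.aemeasurable (by fun_prop)]
  rw [hint] at hslln
  filter_upwards [hslln] with x hx
  refine hasAvg_iff_tendsto_backwardAvg.2 ?_
  have h := ((tendsto_add_atTop_iff_nat 1).2 hx).mul tendsto_succ_div
  rw [mul_one] at h
  refine h.congr fun N => ?_
  have hsum : ∑ k ∈ Finset.Icc (-(N : ℤ)) 0, x k = ∑ i ∈ Finset.range (N + 1), x (-i) := by
    symm
    refine Finset.sum_bij (fun i _ => -(i : ℤ)) ?_ ?_ ?_ fun _ _ => rfl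
    · intro i hi; simp at hi ⊢; omega
    · intro i _ j _ hij; simpa using hij
    · intro k hk
      rw [Finset.mem_Icc] at hk
      exact ⟨(-k).toNat, by simp; omega, by omega⟩
  rw [backwardAvg, hsum]
  have : (N : ℝ) + 1 ≠ 0 := by positivity
  push_cast
  field_simp

/-- The law of a sequence of independent exponential variables with mean `ρ`. -/
abbrev expSeq (ρ : ℝ) : Measure (ℤ → ℝ) := Measure.infinitePi fun _ : ℤ => expMeasure ρ⁻¹

theorem isProbabilityMeasure_expSeq {ρ : ℝ} (hρ : 0 < ρ) : IsProbabilityMeasure (expSeq ρ) := by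
  have := isProbabilityMeasure_expMeasure (inv_pos.2 hρ)
  infer_instance

theorem ae_hasAvg_expSeq {ρ : ℝ} (hρ : 0 < ρ) : ∀ᵐ x ∂expSeq ρ, HasAvg x ρ := by
  have := isProbabilityMeasure_expMeasure (inv_pos.2 hρ)
  have h := ae_hasAvg_infinitePi _ (integrable_id_expMeasure (inv_pos.2 hρ))
  rwa [integral_id_expMeasure (inv_pos.2 hρ), inv_inv] at h

theorem ae_nonneg_expSeq {ρ : ℝ} (hρ : 0 < ρ) : ∀ᵐ x ∂expSeq ρ, ∀ k, 0 ≤ x k := by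
  have := isProbabilityMeasure_expMeasure (inv_pos.2 hρ)
  rw [ae_all_iff]
  intro k
  exact (measurePreserving_eval_infinitePi (fun _ : ℤ => expMeasure ρ⁻¹) k).quasiMeasurePreserving.ae
    (ae_nonneg_expMeasure ρ⁻¹)

/-! ### Queues started at a finite time -/

/-- The sojourn time of customer `k + N` if that of customer `k` is `s`. -/
def sojournFrom (I ω : ℤ → ℝ) (k : ℤ) (s : ℝ) : ℕ → ℝ
  | 0 => s
  | N + 1 => ω (k + N + 1) + max 0 (sojournFrom I ω k s N - I (k + N + 1))

section SojournFrom

variable {I ω : ℤ → ℝ} {a b s : ℝ}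

theorem sojournFrom_zero_nonneg (hω : ∀ k, 0 ≤ ω k) (k : ℤ) (N : ℕ) :
    0 ≤ sojournFrom I ω k 0 N := by
  cases N with
  | zero => exact le_rfl
  | succ N => exact add_nonneg (hω _) (le_max_left _ _)

/-- The initial state matters only through the scenario in which the server never idles; every idle
period erases it. -/
theorem sojournFrom_eq_max (hs : 0 ≤ s) (k : ℤ) (N : ℕ) :
    sojournFrom I ω k s N = max (sojournFrom I ω k 0 N)
      (s + (arrivalTime ω (k + N) - arrivalTime ω k) -
        (arrivalTime I (k + N) - arrivalTime I k)) := by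
  induction N with
  | zero => simp [sojournFrom, hs]
  | succ N ih =>
    have h1 := arrivalTime_sub I (k + N + 1)
    have h2 := arrivalTime_sub ω (k + N + 1)
    rw [add_sub_cancel_right] at h1 h2
    simp only [sojournFrom]
    push_cast
    rw [← add_assoc, ih]
    generalize sojournFrom I ω k 0 N = F
    grind

theorem Stable.sojourn_eq_sojournFrom (h : Stable I ω) (k : ℤ) (N : ℕ) :
    sojourn I ω (k + N) = sojournFrom I ω k (sojourn I ω k) N := by
  induction N with
  | zero => simp [sojournFrom]
  | succ N ih =>
    have := h.sojourn_eq (k + N + 1)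
    rw [add_sub_cancel_right] at this
    simp only [sojournFrom]
    push_cast
    rw [← ih, ← add_assoc, this]

/-- A queue started in the remote past from any state has reached the stationary state. -/
theorem eventually_sojournFrom_eq (hI : HasAvg I a) (hω : HasAvg ω b) (hab : b < a)
    (hω0 : ∀ k, 0 ≤ ω k) (hs : 0 ≤ s) (l : ℤ) :
    ∀ᶠ k in atBot, sojournFrom I ω k s (l - k).toNat = sojourn I ω l := by
  have hst := hI.stable hω hab
  -- By the drift, the never-idle term in `sojournFrom_eq_max` is negative for remote `k`, for the
  -- initial state `s` (`h1`) and for the stationary one (`h2`). Both queues then agree with the one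
  -- started from `0`.
  have h1 := (hI.tendsto_sub hω hab).eventually
    (eventually_lt_atBot (-(s + (arrivalTime ω l - arrivalTime I l))))
  have h2 := ((hI.queueMap hω hab).tendsto_sub hω hab).eventually
    (eventually_lt_atBot (-(departureTime I ω 0 + (arrivalTime ω l - arrivalTime I l))))
  filter_upwards [h1, h2, eventually_le_atBot l] with k hk1 hk2 hkl
  obtain ⟨N, rfl⟩ : ∃ N : ℕ, l = k + N := ⟨(l - k).toNat, by omega⟩
  have hN : (k + N - k : ℤ).toNat = N := by omega
  have hF := sojournFrom_zero_nonneg (I := I) hω0 k N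
  rw [hN, hst.sojourn_eq_sojournFrom, sojournFrom_eq_max hs,
    sojournFrom_eq_max ((hω0 k).trans (hst.le_sojourn k))]
  rw [arrivalTime_queueMap] at hk2
  rw [max_eq_left (by linarith), max_eq_left]
  rw [sojourn]
  linarith

end SojournFrom

/-- Service of customer `k`, acting on the sojourn time, the arrivals and the services. -/
def serveAt (k : ℤ) (p : ℝ × (ℤ → ℝ) × (ℤ → ℝ)) : ℝ × (ℤ → ℝ) × (ℤ → ℝ) :=
  ((serve (p.1, p.2.1 k, p.2.2 k)).1,
    Function.update p.2.1 k (serve (p.1, p.2.1 k, p.2.2 k)).2.1,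
    Function.update p.2.2 k (serve (p.1, p.2.1 k, p.2.2 k)).2.2)

/-- Service of the customers `k + 1, …, k + N`. -/
def serveFrom (k : ℤ) : ℕ → ℝ × (ℤ → ℝ) × (ℤ → ℝ) → ℝ × (ℤ → ℝ) × (ℤ → ℝ)
  | 0 => id
  | N + 1 => serveAt (k + N + 1) ∘ serveFrom k N

/-- Customers not yet served keep their original data, so each successive `serveAt` reads the
original `I` and `ω`; this identifies the iteration with a queue started at `k`. -/
theorem serveFrom_eq (k : ℤ) (N : ℕ) (s : ℝ) (I ω : ℤ → ℝ) :
    (serveFrom k N (s, I, ω)).1 = sojournFrom I ω k s N ∧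
    (∀ j, k + N < j → (serveFrom k N (s, I, ω)).2.1 j = I j ∧
      (serveFrom k N (s, I, ω)).2.2 j = ω j) ∧
    ∀ j, k < j → j ≤ k + N →
      (serveFrom k N (s, I, ω)).2.1 j =
        ω j + max 0 (I j - sojournFrom I ω k s (j - 1 - k).toNat) ∧
      (serveFrom k N (s, I, ω)).2.2 j = min (I j) (sojournFrom I ω k s (j - 1 - k).toNat) := by
  induction N with
  | zero =>
    exact ⟨rfl, fun j _ => ⟨rfl, rfl⟩, fun j h1 h2 => absurd h1 (by simp at h2; omega)⟩
  | succ N ih =>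
    obtain ⟨h1, h2, h3⟩ := ih
    obtain ⟨e1, e2⟩ := h2 (k + N + 1) (by omega)
    simp only [serveFrom, Function.comp, serveAt, h1, e1, e2, serve]
    refine ⟨rfl, fun j hj => ?_, fun j hj1 hj2 => ?_⟩
    · have : j ≠ k + N + 1 := by push_cast at hj; omega
      simp only [Function.update_of_ne this]
      exact h2 j (by push_cast at hj; omega)
    · rcases eq_or_ne j (k + N + 1) with rfl | hne
      · simp
      · simp only [Function.update_of_ne hne]
        exact h3 j hj1 (by push_cast at hj2; omega)

theorem measurePreserving_serveAt {β γ : ℝ} (hβ : 0 < β) (hγ : 0 < γ) (k : ℤ) :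
    MeasurePreserving (serveAt k)
      ((expMeasure γ).prod ((Measure.infinitePi fun _ : ℤ => expMeasure β).prod
        (Measure.infinitePi fun _ : ℤ => expMeasure (γ + β))))
      ((expMeasure γ).prod ((Measure.infinitePi fun _ : ℤ => expMeasure β).prod
        (Measure.infinitePi fun _ : ℤ => expMeasure (γ + β)))) := by
  have := isProbabilityMeasure_expMeasure hβ
  have := isProbabilityMeasure_expMeasure hγ
  have := isProbabilityMeasure_expMeasure (add_pos hγ hβ)
  set Pβ := Measure.infinitePi fun _ : ℤ => expMeasure β
  set Pα := Measure.infinitePi fun _ : ℤ => expMeasure (γ + β)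
  -- This map inserts fresh independent variables at coordinate `k` of both sequences. It
  -- intertwines `serve` times the identity with `serveAt k`, so the one-step invariance carries
  -- over.
  have hφ := ((MeasurePreserving.id (expMeasure γ)).prod
    (((measurePreserving_update_infinitePi (expMeasure β) k).prod
      (measurePreserving_update_infinitePi (expMeasure (γ + β)) k)).comp
      (measurePreserving_prodProdProdComm (expMeasure β) (expMeasure (γ + β)) Pβ Pα))).comp
    (measurePreserving_prodAssoc (expMeasure γ) ((expMeasure β).prod (expMeasure (γ + β)))
      (Pβ.prod Pα))
  have hS := (measurePreserving_serve hβ hγ).prod (MeasurePreserving.id (Pβ.prod Pα))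
  have hm : Measurable (serveAt k) := by
    have h1 : Measurable fun p : ℝ × (ℤ → ℝ) × (ℤ → ℝ) => serve (p.1, p.2.1 k, p.2.2 k) :=
      measurable_serve.comp (by fun_prop)
    have hu : Measurable fun p : ℝ × (ℤ → ℝ) => Function.update p.2 k p.1 :=
      (measurePreserving_update_infinitePi (expMeasure β) k).measurable
    exact (measurable_fst.comp h1).prodMk
      ((hu.comp ((measurable_fst.comp (measurable_snd.comp h1)).prodMk
        (measurable_fst.comp measurable_snd))).prodMk
      (hu.comp ((measurable_snd.comp (measurable_snd.comp h1)).prodMk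
        (measurable_snd.comp measurable_snd))))
  refine ⟨hm, ?_⟩
  conv_lhs => rw [← hφ.map_eq]
  rw [Measure.map_map hm hφ.measurable]
  conv_rhs => rw [← (hφ.comp hS).map_eq]
  congr 1
  funext ⟨⟨z, x, w⟩, I, ω⟩
  simp [serveAt, Prod.map, MeasurableEquiv.prodAssoc]

theorem measurePreserving_serveFrom {β γ : ℝ} (hβ : 0 < β) (hγ : 0 < γ) (k : ℤ) (N : ℕ) :
    MeasurePreserving (serveFrom k N)
      ((expMeasure γ).prod ((Measure.infinitePi fun _ : ℤ => expMeasure β).prod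
        (Measure.infinitePi fun _ : ℤ => expMeasure (γ + β))))
      ((expMeasure γ).prod ((Measure.infinitePi fun _ : ℤ => expMeasure β).prod
        (Measure.infinitePi fun _ : ℤ => expMeasure (γ + β)))) := by
  induction N with
  | zero => exact MeasurePreserving.id _
  | succ N ih => exact (measurePreserving_serveAt hβ hγ _).comp ih

/-- Almost sure limits of variables with a common law have that law. -/
theorem map_eq_of_ae_tendsto {Ω X : Type*} [MeasurableSpace Ω] [TopologicalSpace X]
    [TopologicalSpace.PseudoMetrizableSpace X] [MeasurableSpace X] [BorelSpace X]
    {P : Measure Ω} [IsProbabilityMeasure P] {μ : Measure X} {f : ℕ → Ω → X} {g : Ω → X}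
    (hf : ∀ n, MeasurePreserving (f n) P μ) (hg : Measurable g)
    (h : ∀ᵐ p ∂P, Tendsto (fun n => f n p) atTop (𝓝 (g p))) : MeasurePreserving g P μ := by
  let := TopologicalSpace.pseudoMetrizableSpacePseudoMetric X
  have : IsProbabilityMeasure μ := by
    rw [← (hf 0).map_eq]; exact Measure.isProbabilityMeasure_map (hf 0).measurable.aemeasurable
  have : IsProbabilityMeasure (P.map g) := Measure.isProbabilityMeasure_map hg.aemeasurable
  refine ⟨hg, ext_of_forall_integral_eq_of_IsFiniteMeasure fun φ => ?_⟩
  have hφ : StronglyMeasurable φ := φ.continuous.measurable.stronglyMeasurable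
  rw [integral_map hg.aemeasurable hφ.aestronglyMeasurable]
  have h1 : Tendsto (fun n => ∫ p, φ (f n p) ∂P) atTop (𝓝 (∫ p, φ (g p) ∂P)) := by
    refine tendsto_integral_of_dominated_convergence (fun _ => ‖φ‖)
      (fun n => (hφ.comp_measurable (hf n).measurable).aestronglyMeasurable)
      (integrable_const _) (fun n => ae_of_all _ fun p => φ.norm_coe_le_norm _) ?_
    filter_upwards [h] with p hp
    exact (φ.continuous.tendsto _).comp hp
  have h2 : ∀ n, ∫ p, φ (f n p) ∂P = ∫ x, φ x ∂μ := by
    intro n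
    rw [← (hf n).map_eq, integral_map (hf n).measurable.aemeasurable hφ.aestronglyMeasurable]
  simp only [h2] at h1
  exact tendsto_nhds_unique tendsto_const_nhds h1 |>.symm

/-- **Burke's theorem**: departures and dual services of a queue with independent exponential
interarrival and service times are independent, with the laws of the arrivals and the services. -/
theorem measurePreserving_queueMap_dualService {a b : ℝ} (hb : 0 < b) (hba : b < a) :
    MeasurePreserving (fun p : (ℤ → ℝ) × (ℤ → ℝ) => (queueMap p.1 p.2, dualService p.1 p.2))
      ((expSeq a).prod (expSeq b)) ((expSeq a).prod (expSeq b)) := by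
  have ha := hb.trans hba
  have hβ := inv_pos.2 ha
  -- The equilibrium rate of the sojourn time: added to the arrival rate `a⁻¹` it gives the service
  -- rate `b⁻¹`, as `measurePreserving_serve` requires.
  have hγ : 0 < b⁻¹ - a⁻¹ := sub_pos.2 (inv_strictAnti₀ hb hba)
  have := isProbabilityMeasure_expMeasure hγ
  have := isProbabilityMeasure_expSeq ha
  have := isProbabilityMeasure_expSeq hb
  have hg : Measurable fun p : (ℤ → ℝ) × (ℤ → ℝ) => (queueMap p.1 p.2, dualService p.1 p.2) :=
    measurable_queueMap.prodMk measurable_dualService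
  have hsnd : MeasurePreserving Prod.snd ((expMeasure (b⁻¹ - a⁻¹)).prod
      ((expSeq a).prod (expSeq b))) ((expSeq a).prod (expSeq b)) := measurePreserving_snd
  -- The queue starts in equilibrium at customer `-n` and serves the customers up to `n`. As `n`
  -- grows, each fixed coordinate eventually equals its stationary value.
  have hF (n : ℕ) : MeasurePreserving (fun p => (serveFrom (-n) (2 * n) p).2)
      ((expMeasure (b⁻¹ - a⁻¹)).prod ((expSeq a).prod (expSeq b)))
      ((expSeq a).prod (expSeq b)) := by
    have := measurePreserving_serveFrom hβ hγ (-n) (2 * n)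
    rw [sub_add_cancel] at this
    exact hsnd.comp this
  have key : MeasurePreserving
      ((fun p : (ℤ → ℝ) × (ℤ → ℝ) => (queueMap p.1 p.2, dualService p.1 p.2)) ∘ Prod.snd)
      ((expMeasure (b⁻¹ - a⁻¹)).prod ((expSeq a).prod (expSeq b)))
      ((expSeq a).prod (expSeq b)) := by
    refine map_eq_of_ae_tendsto hF (hg.comp measurable_snd) ?_
    have hz := (measurePreserving_fst (μ := expMeasure (b⁻¹ - a⁻¹))
      (ν := (expSeq a).prod (expSeq b))).quasiMeasurePreserving.ae (ae_nonneg_expMeasure _)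
    have hI := (measurePreserving_fst (μ := expSeq a) (ν := expSeq b)
      |>.comp hsnd).quasiMeasurePreserving.ae (ae_hasAvg_expSeq ha)
    have hω := (measurePreserving_snd (μ := expSeq a) (ν := expSeq b)
      |>.comp hsnd).quasiMeasurePreserving.ae ((ae_hasAvg_expSeq hb).and (ae_nonneg_expSeq hb))
    filter_upwards [hz, hI, hω] with p hz hI hω
    obtain ⟨z, I, ω⟩ := p
    obtain ⟨hω, hω0⟩ := hω
    simp only [Function.comp] at hz hI hω hω0 ⊢
    have hst := hI.stable hω hba
    have hneg : Tendsto (fun n : ℕ => -(n : ℤ)) atTop atBot :=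
      tendsto_neg_atTop_atBot.comp tendsto_natCast_atTop_atTop
    have hev (j : ℤ) : ∀ᶠ n : ℕ in atTop,
        (serveFrom (-n) (2 * n) (z, I, ω)).2.1 j = queueMap I ω j ∧
          (serveFrom (-n) (2 * n) (z, I, ω)).2.2 j = dualService I ω j := by
      filter_upwards [hneg.eventually (eventually_sojournFrom_eq hI hω hba hω0 hz (j - 1)),
        eventually_gt_atTop j.natAbs] with n hn hjn
      obtain ⟨h1, h2⟩ := (serveFrom_eq (-n) (2 * n) z I ω).2.2 j (by omega) (by push_cast; omega)
      rw [h1, h2, hn, hst.queueMap_eq, dualService]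
      exact ⟨rfl, rfl⟩
    refine Tendsto.prodMk_nhds (tendsto_pi_nhds.2 fun j => ?_) (tendsto_pi_nhds.2 fun j => ?_)
    · exact tendsto_const_nhds.congr' ((hev j).mono fun n hn => hn.1.symm)
    · exact tendsto_const_nhds.congr' ((hev j).mono fun n hn => hn.2.symm)
  refine ⟨hg, ?_⟩
  rw [← hsnd.map_eq, Measure.map_map hg measurable_snd, key.map_eq, hsnd.map_eq]

/-! ### The measures, one service at a time -/

section Measures

variable {n : ℕ}

theorem isProbabilityMeasure_nu {ρ : Fin n → ℝ} (hρ : ∀ i, 0 < ρ i) :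
    IsProbabilityMeasure (nu ρ) := by
  have := fun i => isProbabilityMeasure_expSeq (hρ i)
  exact inferInstanceAs (IsProbabilityMeasure (Measure.infinitePi fun i => expSeq (ρ i)))

theorem isProbabilityMeasure_mu {ρ : Fin n → ℝ} (hρ : ∀ i, 0 < ρ i) :
    IsProbabilityMeasure (mu ρ) :=
  have := isProbabilityMeasure_nu hρ
  Measure.isProbabilityMeasure_map (measurable_jointMap n).aemeasurable

theorem measurePreserving_cons_nu {ρ : Fin (n + 1) → ℝ} (hρ : ∀ i, 0 < ρ i) :
    MeasurePreserving (fun p : (ℤ → ℝ) × Seqs n => (Fin.cons p.1 p.2 : Seqs (n + 1)))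
      ((expSeq (ρ 0)).prod (nu (Fin.tail ρ))) (nu ρ) := by
  have := fun i => isProbabilityMeasure_expSeq (hρ i)
  have := fun i => isProbabilityMeasure_expSeq (hρ (Fin.succ i))
  have h1 : nu ρ = Measure.pi fun i => expSeq (ρ i) := Measure.infinitePi_eq_pi _
  have h2 : nu (Fin.tail ρ) = Measure.pi fun i : Fin n => expSeq (ρ i.succ) :=
    Measure.infinitePi_eq_pi fun i : Fin n => expSeq (ρ i.succ)
  rw [h1, h2]
  have h := (measurePreserving_piFinSuccAbove (fun i => expSeq (ρ i)) 0).symm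
  simp only [Fin.zero_succAbove] at h
  convert h using 1
  funext p
  exact (Fin.insertNth_zero' p.1 p.2).symm

/-- The law-level form of `jointMap_succ`: the last service is independent of the joint output of
the remaining sequences. It allows induction on `μ^ρ` without returning to `ν^ρ`. -/
theorem measurePreserving_queueStep_mu {ρ : Fin (n + 1) → ℝ} (hρ : ∀ i, 0 < ρ i) :
    MeasurePreserving (fun p : (ℤ → ℝ) × Seqs n => queueStep p.1 p.2)
      ((expSeq (ρ 0)).prod (mu (Fin.tail ρ))) (mu ρ) := by
  have := isProbabilityMeasure_expSeq (hρ 0)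
  have := isProbabilityMeasure_nu (ρ := Fin.tail ρ) fun i => hρ i.succ
  have h1 : MeasurePreserving (jointMap n) (nu (Fin.tail ρ)) (mu (Fin.tail ρ)) :=
    ⟨measurable_jointMap n, rfl⟩
  have h2 := (MeasurePreserving.id (expSeq (ρ 0))).prod h1
  refine ⟨measurable_queueStep n, ?_⟩
  rw [← h2.map_eq, Measure.map_map (measurable_queueStep n) h2.measurable, mu,
    ← (measurePreserving_cons_nu hρ).map_eq,
    Measure.map_map (measurable_jointMap _) (measurable_cons n)]
  congr 1
  funext p
  exact (jointMap_cons p.1 p.2).symm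

theorem ae_nu_eval {ρ : Fin n → ℝ} (hρ : ∀ i, 0 < ρ i) {p : Fin n → (ℤ → ℝ) → Prop}
    (h : ∀ i, ∀ᵐ x ∂expSeq (ρ i), p i x) : ∀ᵐ I ∂nu ρ, ∀ i, p i (I i) := by
  have := fun i => isProbabilityMeasure_expSeq (hρ i)
  rw [ae_all_iff]
  exact fun i => (measurePreserving_eval_infinitePi (fun i => expSeq (ρ i))
    i).quasiMeasurePreserving.ae (h i)

theorem ae_mem_arrivalSpace {ρ : Fin n → ℝ} (hρ : ρ ∈ paramSpace n) :
    ∀ᵐ I ∂nu ρ, I ∈ arrivalSpace n := by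
  filter_upwards [ae_nu_eval hρ.1 (p := fun _ x => ∀ k, 0 ≤ x k) fun i => ae_nonneg_expSeq (hρ.1 i),
    ae_nu_eval hρ.1 (p := fun i x => HasAvg x (ρ i)) fun i => ae_hasAvg_expSeq (hρ.1 i)]
    with I h0 hI
  exact ⟨h0, ρ, fun i => hasAvg_iff_tendsto_backwardAvg.1 (hI i), hρ⟩

theorem measurableSet_hasAvg (a : ℝ) : MeasurableSet {x : ℤ → ℝ | HasAvg x a} := by
  simp only [hasAvg_iff_tendsto_backwardAvg]
  refine measurableSet_tendsto (𝓝 a) fun N => ?_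
  unfold backwardAvg
  fun_prop

theorem measurableSet_forall_hasAvg (a : Fin n → ℝ) :
    MeasurableSet {η : Seqs n | ∀ i, HasAvg (η i) (a i)} := by
  rw [Set.ofPred_forall]
  exact MeasurableSet.iInter fun i =>
    (measurable_pi_apply i : Measurable fun η : Seqs n => η i) (measurableSet_hasAvg (a i))

theorem ae_mu_hasAvg {ρ : Fin n → ℝ} (hρ : ρ ∈ paramSpace n) :
    ∀ᵐ η ∂mu ρ, ∀ i, HasAvg (η i) (ρ i) := by
  rw [mu, ae_map_iff (measurable_jointMap n).aemeasurable
    (measurableSet_forall_hasAvg ρ)]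
  filter_upwards [ae_nu_eval hρ.1 (p := fun i x => HasAvg x (ρ i)) fun i => ae_hasAvg_expSeq (hρ.1 i)]
    with I hI
  exact hasAvg_jointMap hI hρ.2

theorem tail_mem_paramSpace {ρ : Fin (n + 1) → ℝ} (hρ : ρ ∈ paramSpace (n + 1)) :
    Fin.tail ρ ∈ paramSpace n :=
  ⟨fun i => hρ.1 i.succ, StrictMono.fin_tail hρ.2⟩

/-- `μ^ρ` is invariant under service with independent exponential service times. -/
theorem measurePreserving_queueAll_mu {r : ℝ} (hr : 0 < r) {ρ : Fin n → ℝ}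
    (hρ : ρ ∈ paramSpace n) (hrρ : ∀ i, r < ρ i) :
    MeasurePreserving (fun p : (ℤ → ℝ) × Seqs n => queueAll p.1 p.2)
      ((expSeq r).prod (mu ρ)) (mu ρ) := by
  have := isProbabilityMeasure_expSeq hr
  have := isProbabilityMeasure_mu hρ.1
  induction n with
  | zero =>
    refine ⟨measurable_queueAll 0, ?_⟩
    have := Measure.isProbabilityMeasure_map (μ := (expSeq r).prod (mu ρ))
      (measurable_queueAll 0).aemeasurable
    ext s
    rcases s.eq_empty_or_nonempty with rfl | hs
    · simp
    · rw [Subsingleton.eq_univ_of_nonempty hs, measure_univ, measure_univ]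
  | succ n ih =>
    set s := ρ 0
    have hs : 0 < s := hρ.1 0
    have hρ' := tail_mem_paramSpace hρ
    have := isProbabilityMeasure_expSeq hs
    have := isProbabilityMeasure_mu hρ'.1
    have hstep := measurePreserving_queueStep_mu hρ.1
    have ih' := ih hρ' (fun i => hrρ i.succ) this
    -- With `η = queueStep y ξ`, interchange turns service by `x` into service of `ξ` first by `R(y,
    -- x)` and then by `D(y, x)`. By Burke these two are independent with the laws of `x` and `y`;
    -- the induction hypothesis absorbs `R(y, x)`, and the step with `D(y, x)` rebuilds `μ^ρ`.
    have hB := (measurePreserving_queueMap_dualService hr (hrρ 0)).comp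
      (Measure.measurePreserving_swap (μ := expSeq r) (ν := expSeq s))
    have hB' := (measurePreserving_prodAssoc (expSeq s) (expSeq r) (mu (Fin.tail ρ))).comp
      ((hB.prod (MeasurePreserving.id (mu (Fin.tail ρ)))).comp
        ((measurePreserving_prodAssoc (expSeq r) (expSeq s) (mu (Fin.tail ρ))).symm _))
    have hR := hstep.comp (((MeasurePreserving.id (expSeq s)).prod ih').comp hB')
    have hL := (MeasurePreserving.id (expSeq r)).prod hstep
    refine ⟨measurable_queueAll _, ?_⟩
    rw [← hL.map_eq, Measure.map_map (measurable_queueAll _) hL.measurable]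
    refine Eq.trans ?_ hR.map_eq
    refine Measure.map_congr ?_
    have hx := (measurePreserving_fst (μ := expSeq r)
      (ν := (expSeq s).prod (mu (Fin.tail ρ)))).quasiMeasurePreserving.ae (ae_hasAvg_expSeq hr)
    have hy := ((measurePreserving_fst (μ := expSeq s) (ν := mu (Fin.tail ρ))).comp
      (measurePreserving_snd (μ := expSeq r)
      (ν := (expSeq s).prod (mu (Fin.tail ρ))))).quasiMeasurePreserving.ae (ae_hasAvg_expSeq hs)
    have hξ := ((measurePreserving_snd (μ := expSeq s) (ν := mu (Fin.tail ρ))).comp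
      (measurePreserving_snd (μ := expSeq r)
      (ν := (expSeq s).prod (mu (Fin.tail ρ))))).quasiMeasurePreserving.ae (ae_mu_hasAvg hρ')
    filter_upwards [hx, hy, hξ] with p hx hy hξ
    obtain ⟨x, y, ξ⟩ := p
    change queueAll x (queueStep y ξ) = queueStep (queueMap y x) (queueAll (dualService y x) ξ)
    funext i
    refine Fin.cases rfl (fun j => ?_) i
    exact (hξ j).queueMap_queueMap hy hx (hρ.2 (Fin.succ_pos j)) (hrρ 0)

theorem measurable_deleteSeq (j : Fin (n + 1)) : Measurable (deleteSeq j) :=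
  measurable_pi_iff.2 fun _ => measurable_pi_apply _

/-- Consistency of the measures `μ^ρ`. -/
theorem measurePreserving_deleteSeq_mu {ρ : Fin (n + 1) → ℝ} (hρ : ρ ∈ paramSpace (n + 1))
    (j : Fin (n + 1)) : MeasurePreserving (deleteSeq j) (mu ρ) (mu (deleteParam j ρ)) := by
  refine ⟨measurable_deleteSeq j, ?_⟩
  have hstep := measurePreserving_queueStep_mu hρ.1
  have hρ' := tail_mem_paramSpace hρ
  have := isProbabilityMeasure_expSeq (hρ.1 0)
  have := isProbabilityMeasure_mu hρ'.1
  rw [← hstep.map_eq, Measure.map_map (measurable_deleteSeq j) hstep.measurable]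
  induction n with
  | zero =>
    obtain rfl : j = 0 := Subsingleton.elim (α := Fin 1) _ _
    exact (measurePreserving_queueAll_mu (hρ.1 0) hρ' fun i => i.elim0).map_eq
  | succ n ih =>
    revert j
    refine Fin.cases ?_ fun j => ?_
    -- Without its first sequence, `queueStep x ξ` is `queueAll x ξ`, and the law of `ξ` is
    -- invariant under this service.
    · exact (measurePreserving_queueAll_mu (hρ.1 0) hρ' fun i => hρ.2 (Fin.succ_pos i)).map_eq
    -- Deleting a later sequence commutes with the common last service, so the deletion can be
    -- carried out in the tail by induction.
    · have h1 : MeasurePreserving (deleteSeq j) (mu (Fin.tail ρ))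
          (mu (deleteParam j (Fin.tail ρ))) := by
        have hstep' := measurePreserving_queueStep_mu hρ'.1
        have := isProbabilityMeasure_expSeq (hρ'.1 0)
        have := isProbabilityMeasure_mu (tail_mem_paramSpace hρ').1
        refine ⟨measurable_deleteSeq j, ?_⟩
        rw [← hstep'.map_eq, Measure.map_map (measurable_deleteSeq j) hstep'.measurable]
        exact ih hρ' j hstep' (tail_mem_paramSpace hρ') ‹_› ‹_›
      have h2 := (MeasurePreserving.id (expSeq (ρ 0))).prod h1
      have h3 : deleteParam j.succ ρ = Fin.cons (ρ 0) (deleteParam j (Fin.tail ρ)) := by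
        funext i
        refine Fin.cases ?_ (fun i => ?_) i <;> simp [deleteParam, Fin.tail]
      have h4 := measurePreserving_queueStep_mu (ρ := deleteParam j.succ ρ) fun i => hρ.1 _
      have h5 : Fin.tail (deleteParam j.succ ρ) = deleteParam j (Fin.tail ρ) := by
        rw [h3, Fin.tail_cons]
      have h6 : deleteParam j.succ ρ 0 = ρ 0 := by rw [h3, Fin.cons_zero]
      rw [h5, h6] at h4
      rw [← (h4.comp h2).map_eq]
      congr 1
      funext p
      funext i
      refine Fin.cases ?_ (fun i => ?_) i <;>
        simp [deleteSeq, queueStep, queueAll]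

end Measures

/-! ### Ergodicity -/

/-- An event that is approximated by pairs of independent events is trivial. -/
theorem measure_eq_zero_or_one_of_approx {Ω : Type*} [MeasurableSpace Ω] {P : Measure Ω}
    [IsProbabilityMeasure P] {A : Set Ω} (hA : MeasurableSet A)
    (h : ∀ ε > 0, ∃ C D, MeasurableSet C ∧ MeasurableSet D ∧ P.real (symmDiff A C) ≤ ε ∧
      P.real (symmDiff A D) ≤ ε ∧ P.real (C ∩ D) = P.real C * P.real D) : P A = 0 ∨ P A = 1 := by
  have key : ∀ ε > 0, |P.real A - P.real A * P.real A| ≤ ε := by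
    intro ε hε
    obtain ⟨C, D, hC, hD, h1, h2, h3⟩ := h (ε / 4) (by positivity)
    have hAC := (abs_measureReal_sub_le_measureReal_symmDiff (μ := P) hA.nullMeasurableSet
      hC.nullMeasurableSet).trans h1
    have hAD := (abs_measureReal_sub_le_measureReal_symmDiff (μ := P) hA.nullMeasurableSet
      hD.nullMeasurableSet).trans h2
    have hACD : |P.real A - P.real (C ∩ D)| ≤ ε / 4 + ε / 4 := by
      refine (abs_measureReal_sub_le_measureReal_symmDiff (μ := P) hA.nullMeasurableSet
        (hC.inter hD).nullMeasurableSet).trans ?_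
      refine (measureReal_mono (s₂ := symmDiff A C ∪ symmDiff A D) ?_).trans
        ((measureReal_union_le _ _).trans (add_le_add h1 h2))
      intro x hx
      simp only [Set.mem_symmDiff, Set.mem_inter_iff, Set.mem_union] at hx ⊢
      tauto
    rw [h3] at hACD
    have ha0 : 0 ≤ P.real A := measureReal_nonneg
    have ha1 : P.real A ≤ 1 := measureReal_le_one
    have hc0 : 0 ≤ P.real C := measureReal_nonneg
    have hc1 : P.real C ≤ 1 := measureReal_le_one
    have e : P.real A - P.real A * P.real A = (P.real A - P.real C * P.real D) -
        (P.real A - P.real C) * P.real A - P.real C * (P.real A - P.real D) := by ring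
    have e1 : |(P.real A - P.real C) * P.real A| ≤ ε / 4 := by
      rw [abs_mul, abs_of_nonneg ha0]
      exact (mul_le_of_le_one_right (abs_nonneg _) ha1).trans hAC
    have e2 : |P.real C * (P.real A - P.real D)| ≤ ε / 4 := by
      rw [abs_mul, abs_of_nonneg hc0]
      exact (mul_le_of_le_one_left (abs_nonneg _) hc1).trans hAD
    rw [e]
    rw [abs_le] at *
    constructor <;> linarith
  have h0 : P.real A * (1 - P.real A) = 0 := by
    have : |P.real A - P.real A * P.real A| = 0 :=
      le_antisymm (le_of_forall_pos_le_add fun ε hε => by simpa using key ε hε) (abs_nonneg _)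
    rw [abs_eq_zero] at this
    linarith
  rcases mul_eq_zero.1 h0 with h | h
  · left
    rwa [measureReal_eq_zero_iff] at h
  · right
    have : P.real A = 1 := by linarith
    rwa [measureReal_def, ENNReal.toReal_eq_one_iff] at this

/-- Translation-invariant events of independent variables with translation-invariant laws are
trivial. -/
theorem infinitePi_shift_zero_or_one {ι X : Type*} [MeasurableSpace X] (μ : ι → Measure X)
    [∀ i, IsProbabilityMeasure (μ i)] {A : Set (ι × ℤ → X)} (hA : MeasurableSet A)
    (hinv : ∀ l : ℤ, (fun (x : ι × ℤ → X) p => x (p.1, p.2 + l)) ⁻¹' A = A) :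
    Measure.infinitePi (fun p : ι × ℤ => μ p.1) A = 0 ∨
      Measure.infinitePi (fun p : ι × ℤ => μ p.1) A = 1 := by
  classical
  set P := Measure.infinitePi (fun p : ι × ℤ => μ p.1)
  have hdense : P.MeasureDense (measurableCylinders fun _ : ι × ℤ => X) :=
    Measure.MeasureDense.of_generateFrom_isSetAlgebra_finite P isSetAlgebra_measurableCylinders
      generateFrom_measurableCylinders.symm
  have hind : iIndepFun (fun (p : ι × ℤ) (x : ι × ℤ → X) => x p) P :=
    iIndepFun_infinitePi (P := fun p : ι × ℤ => μ p.1) (X := fun _ x => x) fun _ => measurable_id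
  refine measure_eq_zero_or_one_of_approx hA fun ε hε => ?_
  obtain ⟨C, hC, hAC⟩ := hdense.approx A hA (measure_ne_top _ _) ε hε
  have hCm := hdense.measurable C hC
  have hAC' : P.real (symmDiff A C) ≤ ε := by
    rw [measureReal_def]
    exact ENNReal.toReal_le_of_le_ofReal hε.le hAC.le
  obtain ⟨S, t, ht, rfl⟩ := (mem_measurableCylinders C).1 hC
  obtain ⟨M, hM⟩ : ∃ M : ℤ, ∀ p ∈ S, |p.2| ≤ M := by
    obtain ⟨M, hM⟩ := (S.finite_toSet.image fun p => |p.2|).bddAbove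
    exact ⟨M, fun p hp => hM ⟨p, hp, rfl⟩⟩
  -- Times in `S` lie in `[-M, M]`, so a shift by more than `2 * M` makes `S` disjoint from its
  -- translate. The shifted cylinder is then independent of the original one and, by invariance of
  -- `A`, approximates `A` equally well.
  set l : ℤ := 2 * M + 1
  have hinj : Function.Injective fun p : ι × ℤ => (p.1, p.2 + l) := by
    rintro ⟨i, k⟩ ⟨i', k'⟩ h
    simpa using h
  have hθ : MeasurePreserving (fun (x : ι × ℤ → X) p => x (p.1, p.2 + l)) P P :=
    ⟨by fun_prop, Measure.map_infinitePi_infinitePi_of_inj (P := fun p : ι × ℤ => μ p.1) hinj⟩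
  set D := (fun (x : ι × ℤ → X) (p : ι × ℤ) => x (p.1, p.2 + l)) ⁻¹' cylinder S t with hD
  refine ⟨cylinder S t, D, hCm, hθ.measurable hCm, hAC', ?_, ?_⟩
  · have : symmDiff A D = (fun (x : ι × ℤ → X) (p : ι × ℤ) => x (p.1, p.2 + l)) ⁻¹'
        symmDiff A (cylinder S t) := by
      rw [Set.preimage_symmDiff, hinv l]
    rw [this, hθ.measureReal_preimage (hA.symmDiff hCm).nullMeasurableSet]
    exact hAC'
  · set S' : Finset (ι × ℤ) := S.image fun p => (p.1, p.2 + l)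
    have hdisj : Disjoint S S' := by
      rw [Finset.disjoint_left]
      intro p hp hp'
      obtain ⟨q, hq, rfl⟩ := Finset.mem_image.1 hp'
      have h1 := abs_le.1 (hM _ hp)
      have h2 := abs_le.1 (hM _ hq)
      simp only at h1
      omega
    have hindep := hind.indepFun_finset S S' hdisj fun p => measurable_pi_apply p
    let g : (S' → X) → S → X := fun y p => y ⟨(p.1.1, p.1.2 + l), Finset.mem_image_of_mem _ p.2⟩
    have hg : Measurable g := measurable_pi_iff.2 fun p => measurable_pi_apply _
    have := hindep.measure_inter_preimage_eq_mul t (g ⁻¹' t) ht (hg ht)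
    rw [measureReal_def, measureReal_def, measureReal_def, ← ENNReal.toReal_mul]
    exact congrArg ENNReal.toReal this

theorem map_shift_nu {n : ℕ} {ρ : Fin n → ℝ} (hρ : ∀ i, 0 < ρ i) (l : ℤ) :
    (nu ρ).map (shift l) = nu ρ := by
  have h0 := fun i => isProbabilityMeasure_expMeasure (inv_pos.2 (hρ i))
  have h1 := fun i => isProbabilityMeasure_expSeq (hρ i)
  have h2 := Measure.infinitePi_map_pi (fun i => expSeq (ρ i))
    (f := fun _ (x : ℤ → ℝ) k => x (k + l)) (fun _ => by fun_prop)
  have h3 (i : Fin n) : (expSeq (ρ i)).map (fun (x : ℤ → ℝ) k => x (k + l)) = expSeq (ρ i) :=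
    Measure.map_infinitePi_infinitePi_of_inj (P := fun _ : ℤ => expMeasure (ρ i)⁻¹)
      (add_left_injective l)
  simp only [h3] at h2
  exact h2

theorem nu_zero_or_one {n : ℕ} {ρ : Fin n → ℝ} (hρ : ∀ i, 0 < ρ i) {A : Set (Seqs n)}
    (hA : MeasurableSet A) (hinv : ∀ l : ℤ, shift l ⁻¹' A = A) : nu ρ A = 0 ∨ nu ρ A = 1 := by
  have h0 := fun i => isProbabilityMeasure_expMeasure (inv_pos.2 (hρ i))
  have h1 : (Measure.infinitePi fun p : Fin n × ℤ => expMeasure (ρ p.1)⁻¹).map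
      (MeasurableEquiv.curry (Fin n) ℤ ℝ) = nu ρ :=
    Measure.infinitePi_map_curry fun (i : Fin n) (_ : ℤ) => expMeasure (ρ i)⁻¹
  have hm := (MeasurableEquiv.curry (Fin n) ℤ ℝ).measurable
  rw [← h1, Measure.map_apply hm hA]
  refine infinitePi_shift_zero_or_one (fun i => expMeasure (ρ i)⁻¹) (hm hA) fun l => ?_
  conv_rhs => rw [← hinv l]
  rfl

/-- A factor of an ergodic system is ergodic. As `jointMap_shift` holds for every input, preimages
of invariant sets are exactly invariant. -/
theorem isTranslationErgodic_mu {n : ℕ} {ρ : Fin n → ℝ} (hρ : ∀ i, 0 < ρ i) :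
    IsTranslationErgodic (mu ρ) where
  isProbabilityMeasure := isProbabilityMeasure_mu hρ
  map_shift l := by
    have : shift l ∘ jointMap n = jointMap n ∘ shift l := funext fun I => (jointMap_shift l I).symm
    rw [mu, Measure.map_map (measurable_shift l) (measurable_jointMap n), this,
      ← Measure.map_map (measurable_jointMap n) (measurable_shift l), map_shift_nu hρ]
  zero_or_one A hA hinv := by
    rw [mu, Measure.map_apply (measurable_jointMap n) hA]
    refine nu_zero_or_one hρ (measurable_jointMap n hA) fun l => ?_
    conv_rhs => rw [← hinv l]
    ext I
    simp only [Set.mem_preimage, jointMap_shift]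

/-! ### Continuity in the parameters -/

section Continuity

variable {n : ℕ}

/-- Multiplication of the sequences by the parameters. -/
def scale (ρ : Fin n → ℝ) (E : Seqs n) : Seqs n := fun i k => ρ i * E i k

/-- This couples all `ν^ρ` on the probability space of unit exponentials, so that weak continuity
can follow from almost sure continuity in `ρ`. -/
theorem measurePreserving_scale_nu {ρ : Fin n → ℝ} (hρ : ∀ i, 0 < ρ i) :
    MeasurePreserving (scale ρ) (nu 1) (nu ρ) := by
  have := isProbabilityMeasure_expMeasure one_pos
  have hm : Measurable (scale ρ) := by unfold scale; fun_prop
  refine ⟨hm, ?_⟩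
  have h1 : nu (1 : Fin n → ℝ) =
      Measure.infinitePi fun _ => Measure.infinitePi fun _ : ℤ => expMeasure 1 := by
    simp [nu]
  have h2 (i : Fin n) : (Measure.infinitePi fun _ : ℤ => expMeasure 1).map
      (fun x k => ρ i * x k) = expSeq (ρ i) := by
    have := Measure.infinitePi_map_pi (fun _ : ℤ => expMeasure 1)
      (f := fun _ (x : ℝ) => ρ i * x) (fun _ => by fun_prop)
    rw [this, map_mul_expMeasure (hρ i)]
  have h3 := Measure.infinitePi_map_pi
    (fun _ : Fin n => Measure.infinitePi fun _ : ℤ => expMeasure 1)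
    (f := fun i (x : ℤ → ℝ) k => ρ i * x k) (fun _ => by fun_prop)
  simp only [h2] at h3
  rw [h1]
  exact h3

theorem arrivalTime_const_mul (c : ℝ) (x : ℤ → ℝ) (k : ℤ) :
    arrivalTime (fun k => c * x k) k = c * arrivalTime x k := by
  simp only [arrivalTime, ← Finset.mul_sum]; ring

theorem HasSlope.of_pure {W : ℤ → ℝ} {a : ℝ} (h : HasSlope (pure ()) (fun _ => W) a)
    {T : Type*} (F : Filter T) : HasSlope F (fun _ => W) a := by
  rw [hasSlope_iff] at h ⊢
  intro ε hε
  obtain ⟨K, hK, h⟩ := h ε hε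
  exact ⟨K, hK, Eventually.of_forall fun _ => h⟩

/-- With `G` the partial sums of `x`, uniformity comes from `c t * G k - c t₀ * k = c t * (G k - k)
+ (c t - c t₀) * k`, where `c` is bounded near `t₀`. -/
theorem HasAvg.regular_const_mul {T : Type*} [TopologicalSpace T] {t₀ : T} {c : T → ℝ}
    (hc : ContinuousAt c t₀) {x : ℤ → ℝ} (hx : HasAvg x 1) :
    Regular t₀ (fun t k => c t * x k) (c t₀) where
  cont k := hc.mul continuousAt_const
  slope := by
    have h1 := (hasAvg_iff.1 hx).of_pure (𝓝 t₀)
    have h2 : (fun p : T × ℤ => c p.1) =O[𝓝 t₀ ×ˢ atBot] fun _ => (1 : ℝ) :=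
      (hc.isBigO_one ℝ).comp_tendsto tendsto_fst
    have h3 : (fun p : T × ℤ => c p.1 - c t₀) =o[𝓝 t₀ ×ˢ atBot] fun _ => (1 : ℝ) :=
      ((Asymptotics.isLittleO_one_iff ℝ).2
        (tendsto_sub_nhds_zero_iff.2 hc)).comp_tendsto tendsto_fst
    have h4 := (h2.mul_isLittleO h1).add (h3.mul_isBigO
      (Asymptotics.isBigO_refl (fun p : T × ℤ => (p.2 : ℝ)) _))
    simp only [one_mul] at h4
    refine Asymptotics.IsLittleO.congr_left h4 fun p => ?_
    simp only [arrivalTime_const_mul]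
    ring

theorem scale_mem_arrivalSpace {ρ : Fin n → ℝ} (hρ : ρ ∈ paramSpace n) {E : Seqs n}
    (h0 : ∀ i k, 0 ≤ E i k) (hE : ∀ i, HasAvg (E i) 1) : scale ρ E ∈ arrivalSpace n := by
  refine ⟨fun i k => mul_nonneg (hρ.1 i).le (h0 i k), ρ, fun i => ?_, hρ⟩
  exact hasAvg_iff_tendsto_backwardAvg.1
    (HasAvg.regular_const_mul (T := Unit) (c := fun _ => ρ i) continuousAt_const (hE i))

theorem ae_nu_one : ∀ᵐ E ∂nu (1 : Fin n → ℝ), (∀ i k, 0 ≤ E i k) ∧ ∀ i, HasAvg (E i) 1 :=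
  (ae_nu_eval (fun _ => one_pos) fun _ => ae_nonneg_expSeq one_pos).and
    (ae_nu_eval (fun _ => one_pos) (p := fun _ x => HasAvg x 1) fun _ => ae_hasAvg_expSeq one_pos)

/-- The measures `μ^ρ` live on the output space and depend weakly continuously on `ρ`. -/
theorem exists_continuous_probabilityMeasure (n : ℕ) :
    ∃ M : paramSpace n → ProbabilityMeasure (outputSpace n),
      (∀ ρ, (M ρ : Measure (outputSpace n)).map Subtype.val = mu (ρ : Fin n → ℝ)) ∧
      Continuous M := by
  classical
  have hP := isProbabilityMeasure_nu (ρ := (1 : Fin n → ℝ)) fun _ => one_pos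
  have hgood := ae_nu_one (n := n)
  obtain ⟨E₀, hE₀⟩ := hgood.exists
  let good : Seqs n → Prop := fun E => (∀ i k, 0 ≤ E i k) ∧ ∀ i, HasAvg (E i) 1
  have hgoodm : MeasurableSet {E | good E} := by
    refine MeasurableSet.inter (s₁ := {E | ∀ i k, 0 ≤ E i k}) ?_
      (measurableSet_forall_hasAvg fun _ => 1)
    simp only [Set.ofPred_forall]
    exact MeasurableSet.iInter fun i => MeasurableSet.iInter fun k =>
      measurableSet_le measurable_const (by fun_prop)
  -- Bad samples form a null set; replacing them by one fixed good sample makes `Φ` take values in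
  -- `outputSpace` everywhere, as the subtype demands.
  let g : Seqs n → Seqs n := fun E => if good E then E else E₀
  have hg (E : Seqs n) : good (g E) := by
    by_cases h : good E
    · simpa only [g, if_pos h] using h
    · simpa only [g, if_neg h] using hE₀
  have hgm : Measurable g := Measurable.ite hgoodm measurable_id measurable_const
  let Φ : paramSpace n → Seqs n → outputSpace n := fun ρ E => ⟨jointMap n (scale ρ (g E)),
    jointMap_mem_outputSpace (scale_mem_arrivalSpace ρ.2 (hg E).1 (hg E).2)⟩
  have hΦ (ρ : paramSpace n) (E : Seqs n) (hE : good E) :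
      (Φ ρ E : Seqs n) = jointMap n (scale ρ E) := by simp only [Φ, g, if_pos hE]
  have hmeas (ρ : paramSpace n) : Measurable (Φ ρ) :=
    ((measurable_jointMap n).comp ((measurePreserving_scale_nu ρ.2.1).measurable.comp hgm)).subtype_mk
  have hmap (ρ : paramSpace n) : ((nu 1).map (Φ ρ)).map Subtype.val = mu (ρ : Fin n → ℝ) := by
    have h1 := measurePreserving_scale_nu ρ.2.1
    rw [Measure.map_map measurable_subtype_coe (hmeas ρ), mu, ← h1.map_eq,
      Measure.map_map (measurable_jointMap n) h1.measurable]
    exact Measure.map_congr (hgood.mono fun E hE => hΦ ρ E hE)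
  let M : paramSpace n → ProbabilityMeasure (outputSpace n) := fun ρ =>
    ⟨(nu 1).map (Φ ρ), Measure.isProbabilityMeasure_map (hmeas ρ).aemeasurable⟩
  have hM (ρ : paramSpace n) : (M ρ : Measure (outputSpace n)) = (nu 1).map (Φ ρ) := rfl
  refine ⟨M, hmap, continuous_iff_continuousAt.2 fun ρ₀ =>
    ProbabilityMeasure.tendsto_iff_forall_integral_tendsto.2 fun f => ?_⟩
  have hf : StronglyMeasurable f := f.continuous.measurable.stronglyMeasurable
  simp only [hM, integral_map (hmeas _).aemeasurable hf.aestronglyMeasurable]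
  refine tendsto_integral_filter_of_dominated_convergence (fun _ => ‖f‖)
    (Eventually.of_forall fun ρ => (hf.comp_measurable (hmeas ρ)).aestronglyMeasurable)
    (Eventually.of_forall fun ρ => ae_of_all _ fun E => f.norm_coe_le_norm _)
    (integrable_const _) ?_
  filter_upwards [hgood] with E hE
  refine (f.continuous.tendsto _).comp ?_
  rw [tendsto_subtype_rng]
  simp only [hΦ _ E hE]
  -- For a good sample the scaled inputs are continuous with locally uniform averages at `ρ₀`, which
  -- `regular_jointMap` transfers to every output coordinate.
  have hreg (i : Fin n) : Regular ρ₀ (fun ρ : paramSpace n => scale ρ E i) ((ρ₀ : Fin n → ℝ) i) :=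
    HasAvg.regular_const_mul (T := paramSpace n) (c := fun ρ => (ρ : Fin n → ℝ) i)
      ((continuous_apply i).comp continuous_subtype_val).continuousAt (hE.2 i)
  refine tendsto_pi_nhds.2 fun i => tendsto_pi_nhds.2 fun k => ?_
  exact (regular_jointMap hreg ρ₀.2.2 i).cont k

end Continuity

end MultiQueue

/-- For every number `n + 1 ≥ 1` of sequences: the map `𝒟^{(n+1)}` sends `𝒴_{n+1}` into `𝒳_{n+1}`;
for each admissible `ρ` the measure `ν^ρ` lives on `𝒴_{n+1}` and `μ^ρ` is translation-ergodic; the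
`μ^ρ` are probability measures on `𝒳_{n+1}` that depend weakly continuously on `ρ`; and deleting the
`j`-th sequence turns `μ^ρ` into the measure whose parameter vector is `ρ` without `ρ_j`. -/
theorem theorem3p1 (n : ℕ) :
    Set.MapsTo (MultiQueue.jointMap (n + 1)) (MultiQueue.arrivalSpace (n + 1))
      (MultiQueue.outputSpace (n + 1)) ∧
    (∀ ρ ∈ MultiQueue.paramSpace (n + 1),
      (∀ᵐ I ∂(MultiQueue.nu ρ), I ∈ MultiQueue.arrivalSpace (n + 1)) ∧
      MultiQueue.IsTranslationErgodic (MultiQueue.mu ρ)) ∧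
    (∃ M : MultiQueue.paramSpace (n + 1) → ProbabilityMeasure (MultiQueue.outputSpace (n + 1)),
      (∀ ρ, (M ρ : Measure (MultiQueue.outputSpace (n + 1))).map Subtype.val =
        MultiQueue.mu (ρ : Fin (n + 1) → ℝ)) ∧
      Continuous M) ∧
    (∀ ρ ∈ MultiQueue.paramSpace (n + 1), ∀ j : Fin (n + 1),
      (MultiQueue.mu ρ).map (MultiQueue.deleteSeq j) =
        MultiQueue.mu (MultiQueue.deleteParam j ρ)) :=
  ⟨fun _ hI => MultiQueue.jointMap_mem_outputSpace hI,
    fun _ hρ => ⟨MultiQueue.ae_mem_arrivalSpace hρ, MultiQueue.isTranslationErgodic_mu hρ.1⟩,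
    MultiQueue.exists_continuous_probabilityMeasure (n + 1),
    fun _ hρ j => (MultiQueue.measurePreserving_deleteSeq_mu hρ j).map_eq⟩

end
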